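/- Let $\mathbb{K}$ be a field of characteristic $0$, let $R_n=\mathbb{K}[x_1,\dots,x_n]$, let $D_n$ be the $n$-th Weyl algebra over $\mathbb{K}$ (generated by $x_1,\dots,x_n,\partial_1,\dots,\partial_n$ with relations $\partial_i x_j=x_j\partial_i+\delta_{ij}$, $x_jx_i=x_ix_j$, $\partial_j\partial_i=\partial_i\partial_j$), and let $D_n[s]=D_n\otimes_{\mathbb{K}}\mathbb{K}[s]$. Let $f\in R_n$ be a non-zero polynomial, and let $D_n[s]$ act on the free $R_n[s,\frac1f]$-module $R_n[s,\frac1f]\cdot f^s$ of rank one, where $R_n[s]$ acts by multiplication and $$\partial_i\bigl(g\cdot f^s\bigr)=\Bigl(\frac{\partial g}{\partial x_i}+s\,g\,\frac{\partial f}{\partial x_i}\frac1f\Bigr)\cdot f^s .$$ Let $\operatorname{ann}_{D_n[s]}(f^s)=\{P\in D_n[s] : P\cdot f^s=0\}$, and let $b_f(s)\in\mathbb{K}[s]$ be the Bernstein-Sato polynomial of $f$, that is, the monic polynomial of minimal degree for which there is a $P(s)\in D_n[s]$ with $P(s)f\cdot f^s=b_f(s)\cdot f^s$. Consider the left ideal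 $I=\operatorname{ann}_{D_n[s]}(f^s)+D_n[s]\langle f\rangle$ of $D_n[s]$. For $\alpha\in\mathbb{K}$ let $m_\alpha$ be the multiplicity of $\alpha$ as a root of $b_f(-s)$ (so $m_\alpha=0$ if $\alpha$ is not a root). For an integer $i\ge 0$ let $I:(s+\alpha)^i=\{P\in D_n[s] : P\,(s+\alpha)^i\in I\}$, and for a left ideal $J$ of $D_n[s]$ let $J|_{s=-\alpha}=\{P(-\alpha) : P(s)\in J\}\subseteq D_n$. Then for all $\alpha\in\mathbb{K}$ and all integers $i\ge 0$ the following conditions are equivalent: 1. $m_\alpha>i$; 2. $\bigl(I:(s+\alpha)^i\bigr)+D_n[s]\langle s+\alpha\rangle\neq D_n[s]$; 3. $\bigl(I:(s+\alpha)^i\bigr)\big|_{s=-\alpha}\neq D_n$. -/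

import Mathlib

open Polynomial

noncomputable section

namespace BernsteinSato

/-! The Weyl algebra, by generators and relations. -/

/-- The generators `x_i` and `∂_i` of the `n`-th Weyl algebra. -/
inductive WeylGen (n : ℕ) : Type
  | x : Fin n → WeylGen n
  | d : Fin n → WeylGen n

/-- The defining relations of the `n`-th Weyl algebra:
`∂_i x_j = x_j ∂_i + δ_ij`, `x_j x_i = x_i x_j`, `∂_j ∂_i = ∂_i ∂_j`. -/
inductive WeylRel (n : ℕ) (K : Type*) [Field K] :
    FreeAlgebra K (WeylGen n) → FreeAlgebra K (WeylGen n) → Prop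
  | dx (i j : Fin n) : WeylRel n K
      (FreeAlgebra.ι K (WeylGen.d i) * FreeAlgebra.ι K (WeylGen.x j))
      (FreeAlgebra.ι K (WeylGen.x j) * FreeAlgebra.ι K (WeylGen.d i) + if i = j then 1 else 0)
  | xx (i j : Fin n) : WeylRel n K
      (FreeAlgebra.ι K (WeylGen.x j) * FreeAlgebra.ι K (WeylGen.x i))
      (FreeAlgebra.ι K (WeylGen.x i) * FreeAlgebra.ι K (WeylGen.x j))
  | dd (i j : Fin n) : WeylRel n K
      (FreeAlgebra.ι K (WeylGen.d j) * FreeAlgebra.ι K (WeylGen.d i))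
      (FreeAlgebra.ι K (WeylGen.d i) * FreeAlgebra.ι K (WeylGen.d j))

/-- The `n`-th Weyl algebra `D_n` over `K`. -/
abbrev Weyl (n : ℕ) (K : Type*) [Field K] : Type _ := RingQuot (WeylRel n K)

variable {n : ℕ} {K : Type*} [Field K]

/-- The element `x_i` of the Weyl algebra. -/
def xOp (i : Fin n) : Weyl n K :=
  RingQuot.mkAlgHom K (WeylRel n K) (FreeAlgebra.ι K (WeylGen.x i))

/-- The element `∂_i` of the Weyl algebra. -/
def dOp (i : Fin n) : Weyl n K :=
  RingQuot.mkAlgHom K (WeylRel n K) (FreeAlgebra.ι K (WeylGen.d i))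

theorem xOp_mul_comm (i j : Fin n) : (xOp j * xOp i : Weyl n K) = xOp i * xOp j := by
  simpa [xOp] using RingQuot.mkAlgHom_rel K (WeylRel.xx (K := K) i j)

theorem xOp_range_comm :
    ∀ a ∈ Set.range (xOp : Fin n → Weyl n K), ∀ b ∈ Set.range (xOp : Fin n → Weyl n K),
      a * b = b * a := by
  rintro _ ⟨i, rfl⟩ _ ⟨j, rfl⟩
  exact xOp_mul_comm j i

/-- The subalgebra generated by pairwise commuting elements is a commutative ring. -/
abbrev adjoinCommRing (R : Type*) {A : Type*} [CommRing R] [Ring A] [Algebra R A] {T : Set A}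
    (h : ∀ a ∈ T, ∀ b ∈ T, a * b = b * a) : CommRing (Algebra.adjoin R T) :=
  { (inferInstance : Ring (Algebra.adjoin R T)) with
    mul_comm := (Algebra.isMulCommutative_adjoin R h).is_comm.comm }

/-- The inclusion `R_n = K[x_1, …, x_n] → D_n`, the `K`-algebra homomorphism with `x_i ↦ x_i`
(it is built through the commutative subalgebra that the `x_i` generate). -/
def polyToWeyl : MvPolynomial (Fin n) K →ₐ[K] Weyl n K :=
  letI := adjoinCommRing K (xOp_range_comm (n := n) (K := K))
  (Algebra.adjoin K (Set.range (xOp : Fin n → Weyl n K))).val.comp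
    (MvPolynomial.aeval fun i => ⟨xOp i, Algebra.subset_adjoin ⟨i, rfl⟩⟩)

@[simp]
theorem polyToWeyl_X (i : Fin n) :
    polyToWeyl (MvPolynomial.X i : MvPolynomial (Fin n) K) = xOp i := by
  simp [polyToWeyl]

/-- The ring `D_n[s]` of polynomials over the Weyl algebra in a central variable `s`
(`Polynomial.X` commutes with all coefficients). -/
abbrev WeylS (n : ℕ) (K : Type*) [Field K] : Type _ := (Weyl n K)[X]

/-- The central elements `b(s) ∈ K[s] ⊆ D_n[s]`. -/
def ofS : K[X] →ₐ[K] WeylS n K := Polynomial.mapAlgHom (Algebra.ofId K (Weyl n K))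

/-- The central element `s + α` of `D_n[s]`. -/
def sAdd (α : K) : WeylS n K := X + C (algebraMap K (Weyl n K) α)

/-- The inclusion `R_n → D_n ⊆ D_n[s]`. -/
def ofPoly (f : MvPolynomial (Fin n) K) : WeylS n K := C (polyToWeyl f)

/-- The specialization `D_n[s] → D_n`, `P(s) ↦ P(a)`, for `a ∈ K`; it is surjective, so
that `Ideal.map` along it is the image `{P(a) | P ∈ J}` of a left ideal `J`. -/
def specialize (a : K) : WeylS n K →ₐ[K] Weyl n K :=
  Polynomial.eval₂AlgHom (AlgHom.id K (Weyl n K)) (algebraMap K (Weyl n K) a)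
    fun P => (Algebra.commutes (A := Weyl n K) a P).symm

theorem pderiv_pderiv {R : Type*} [CommRing R] (i j : Fin n) (g : MvPolynomial (Fin n) R) :
    MvPolynomial.pderiv i (MvPolynomial.pderiv j g) =
      MvPolynomial.pderiv j (MvPolynomial.pderiv i g) := by
  have h : ⁅MvPolynomial.pderiv (R := R) i, MvPolynomial.pderiv (R := R) j⁆ = 0 := by
    apply MvPolynomial.derivation_ext
    intro k
    simp [Derivation.commutator_apply, MvPolynomial.pderiv_X, Pi.single_apply, apply_ite]
  have h2 := congrArg (fun d => d g) h
  simpa [Derivation.commutator_apply, sub_eq_zero] using h2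

/-! Extension of derivations to a localization `A[1/a]`. -/

section Localization

variable {S A : Type*} [CommRing S] [CommRing A] [Algebra S A] (a : A) (δ : Derivation S A A)

theorem fst_inl_add_inr {B : Type*} [CommRing B] (b c : B) :
    (TrivSqZeroExt.inl b + TrivSqZeroExt.inr c : TrivSqZeroExt B B).fst = b := by
  simp only [TrivSqZeroExt.fst_add, TrivSqZeroExt.fst_inl, TrivSqZeroExt.fst_inr, add_zero]

theorem snd_inl_add_inr {B : Type*} [CommRing B] (b c : B) :
    (TrivSqZeroExt.inl b + TrivSqZeroExt.inr c : TrivSqZeroExt B B).snd = c := by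
  simp only [TrivSqZeroExt.snd_add, TrivSqZeroExt.snd_inl, TrivSqZeroExt.snd_inr, zero_add]

/-- For a derivation `δ` of `A`, the ring homomorphism `A → A[1/a][ε]`, `ε² = 0`,
`g ↦ g + δ(g) ε`. -/
def dualMap : A →ₐ[S] TrivSqZeroExt (Localization.Away a) (Localization.Away a) where
  toFun g := TrivSqZeroExt.inl (algebraMap A (Localization.Away a) g) +
    TrivSqZeroExt.inr (algebraMap A (Localization.Away a) (δ g))
  map_one' := by
    refine TrivSqZeroExt.ext ?_ ?_
    · simp only [fst_inl_add_inr, map_one, TrivSqZeroExt.fst_one]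
    · simp only [snd_inl_add_inr, Derivation.map_one_eq_zero, map_zero, TrivSqZeroExt.snd_one]
  map_mul' g h := by
    refine TrivSqZeroExt.ext ?_ ?_
    · simp only [fst_inl_add_inr, TrivSqZeroExt.fst_mul, map_mul]
    · simp only [fst_inl_add_inr, snd_inl_add_inr, TrivSqZeroExt.snd_mul, Derivation.leibniz,
        map_add, map_mul, smul_eq_mul, MulOpposite.smul_eq_mul_unop, MulOpposite.unop_op]
      ring
  map_zero' := by
    refine TrivSqZeroExt.ext ?_ ?_
    · simp only [fst_inl_add_inr, map_zero, TrivSqZeroExt.fst_zero]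
    · simp only [snd_inl_add_inr, map_zero, TrivSqZeroExt.snd_zero]
  map_add' g h := by
    refine TrivSqZeroExt.ext ?_ ?_
    · rw [fst_inl_add_inr, TrivSqZeroExt.fst_add, fst_inl_add_inr, fst_inl_add_inr, map_add]
    · rw [snd_inl_add_inr, TrivSqZeroExt.snd_add, snd_inl_add_inr, snd_inl_add_inr, map_add,
        map_add]
  commutes' r := by
    refine TrivSqZeroExt.ext ?_ ?_
    · simp only [fst_inl_add_inr, TrivSqZeroExt.algebraMap_eq_inl', TrivSqZeroExt.fst_inl,
        IsScalarTower.algebraMap_apply S A (Localization.Away a)]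
    · simp only [snd_inl_add_inr, TrivSqZeroExt.algebraMap_eq_inl', TrivSqZeroExt.snd_inl,
        Derivation.map_algebraMap, map_zero]

theorem fst_dualMap (g : A) : (dualMap a δ g).fst = algebraMap A (Localization.Away a) g :=
  fst_inl_add_inr _ _

theorem snd_dualMap (g : A) : (dualMap a δ g).snd = algebraMap A (Localization.Away a) (δ g) :=
  snd_inl_add_inr _ _

theorem isUnit_dualMap : IsUnit (dualMap a δ a) := by
  rw [TrivSqZeroExt.isUnit_iff_isUnit_fst]
  rw [fst_dualMap]
  exact IsLocalization.Away.algebraMap_isUnit a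

/-- The extension of `dualMap` to `A[1/a] → A[1/a][ε]`. -/
def dualLift : Localization.Away a →ₐ[S]
    TrivSqZeroExt (Localization.Away a) (Localization.Away a) :=
  IsLocalization.Away.liftAlgHom a (isUnit_dualMap a δ)

theorem dualLift_algebraMap (g : A) :
    dualLift a δ (algebraMap A (Localization.Away a) g) = dualMap a δ g :=
  IsLocalization.Away.lift_eq a (isUnit_dualMap a δ) g

theorem fst_dualLift (g : Localization.Away a) : (dualLift a δ g).fst = g := by
  have h : (((TrivSqZeroExt.fstHom S (Localization.Away a) (Localization.Away a)).comp
      (dualLift a δ) : Localization.Away a →ₐ[S] Localization.Away a) :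
      Localization.Away a →+* Localization.Away a) = RingHom.id _ := by
    apply IsLocalization.ringHom_ext (Submonoid.powers a)
    ext g
    simp [dualLift_algebraMap, fst_dualMap]
  exact congrArg (fun F : Localization.Away a →+* Localization.Away a => F g) h

/-- The derivation of `A[1/a]` that extends the derivation `δ` of `A`. -/
def locDerivation : Derivation S (Localization.Away a) (Localization.Away a) where
  toFun g := (dualLift a δ g).snd
  map_add' g h := by simp
  map_smul' r g := by simp
  map_one_eq_zero' := by simp
  leibniz' g h := by simp [TrivSqZeroExt.snd_mul, fst_dualLift, mul_comm]

@[simp]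
theorem locDerivation_algebraMap (g : A) :
    locDerivation a δ (algebraMap A (Localization.Away a) g) =
      algebraMap A (Localization.Away a) (δ g) := by
  change (dualLift a δ _).snd = _
  rw [dualLift_algebraMap, snd_dualMap]

theorem derivation_ext (δ₁ δ₂ : Derivation S (Localization.Away a) (Localization.Away a))
    (h : ∀ g : A, δ₁ (algebraMap A (Localization.Away a) g) =
      δ₂ (algebraMap A (Localization.Away a) g)) : δ₁ = δ₂ := by
  ext z
  obtain ⟨k, g, hg⟩ := IsLocalization.Away.surj a z
  have h1 := h g
  have hp := h (a ^ k)
  rw [map_pow] at hp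
  rw [← hg, Derivation.leibniz, Derivation.leibniz, hp, add_right_inj] at h1
  have hu : IsUnit (algebraMap A (Localization.Away a) a ^ k) :=
    (IsLocalization.Away.algebraMap_isUnit a).pow k
  exact hu.mul_left_cancel h1

end Localization

/-! The left `D_n[s]`-module `M = R_n[s, 1/f] · f^s`. -/

/-- `f ∈ R_n` as an element of `R_n[s]`, where `R_n[s]` is realized as `K[s][x_1, …, x_n]`. -/
def toRS (f : MvPolynomial (Fin n) K) : MvPolynomial (Fin n) K[X] := MvPolynomial.map C f

/-- The ring `R_n[s, 1/f]`. -/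
abbrev LocRS (f : MvPolynomial (Fin n) K) : Type _ := Localization.Away (toRS f)

/-- The element `1/f` of `R_n[s, 1/f]`. -/
def invf (f : MvPolynomial (Fin n) K) : LocRS f := IsLocalization.Away.invSelf (toRS f)

/-- `∂/∂x_i` on `R_n[s, 1/f]`, a `K[s]`-linear derivation. -/
def locPderiv (f : MvPolynomial (Fin n) K) (i : Fin n) : Derivation K[X] (LocRS f) (LocRS f) :=
  locDerivation (toRS f) (MvPolynomial.pderiv i)

/-- The logarithmic derivative `(∂f/∂x_i) · (1/f)` in `R_n[s, 1/f]`. -/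
def logDeriv (f : MvPolynomial (Fin n) K) (i : Fin n) : LocRS f :=
  algebraMap (MvPolynomial (Fin n) K[X]) (LocRS f) (toRS (MvPolynomial.pderiv i f)) * invf f

/-- The action of `x_i` on `M`, with `g · f^s` represented by `g`. -/
def xAct (f : MvPolynomial (Fin n) K) (i : Fin n) : Module.End K[X] (LocRS f) :=
  LinearMap.mulLeft K[X] (algebraMap (MvPolynomial (Fin n) K[X]) (LocRS f) (MvPolynomial.X i))

/-- The action of `∂_i` on `M`, with `g · f^s` represented by `g`:
`∂_i (g · f^s) = (∂g/∂x_i + s g (∂f/∂x_i) (1/f)) · f^s`. -/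
def dAct (f : MvPolynomial (Fin n) K) (i : Fin n) : Module.End K[X] (LocRS f) :=
  (locPderiv f i).toLinearMap + (X : K[X]) • LinearMap.mulLeft K[X] (logDeriv f i)

theorem locPderiv_comm (f : MvPolynomial (Fin n) K) (i j : Fin n) (g : LocRS f) :
    locPderiv f i (locPderiv f j g) = locPderiv f j (locPderiv f i g) := by
  have h : ⁅locPderiv f i, locPderiv f j⁆ = 0 := by
    apply derivation_ext
    intro g
    have := pderiv_pderiv i j g
    simp [Derivation.commutator_apply, locPderiv, this]
  have h2 := congrArg (fun d => d g) h
  simpa [Derivation.commutator_apply, sub_eq_zero] using h2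

theorem logDeriv_mul (f : MvPolynomial (Fin n) K) (i : Fin n) :
    logDeriv f i * algebraMap (MvPolynomial (Fin n) K[X]) (LocRS f) (toRS f) =
      algebraMap (MvPolynomial (Fin n) K[X]) (LocRS f) (toRS (MvPolynomial.pderiv i f)) := by
  have := IsLocalization.Away.mul_invSelf (S := LocRS f) (toRS f)
  rw [logDeriv, invf, mul_assoc, mul_comm (IsLocalization.Away.invSelf _), this, mul_one]

theorem locPderiv_toRS (f g : MvPolynomial (Fin n) K) (i : Fin n) :
    locPderiv f i (algebraMap (MvPolynomial (Fin n) K[X]) (LocRS f) (toRS g)) =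
      algebraMap (MvPolynomial (Fin n) K[X]) (LocRS f) (toRS (MvPolynomial.pderiv i g)) := by
  rw [locPderiv, locDerivation_algebraMap]
  exact congrArg _ MvPolynomial.pderiv_map

theorem locPderiv_logDeriv (f : MvPolynomial (Fin n) K) (i j : Fin n) :
    locPderiv f i (logDeriv f j) = locPderiv f j (logDeriv f i) := by
  have hu : IsUnit (algebraMap (MvPolynomial (Fin n) K[X]) (LocRS f) (toRS f)) :=
    IsLocalization.Away.algebraMap_isUnit (toRS f)
  have h1 := congrArg (locPderiv f i) (logDeriv_mul f j)
  have h2 := congrArg (locPderiv f j) (logDeriv_mul f i)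
  rw [Derivation.leibniz, locPderiv_toRS, locPderiv_toRS, ← logDeriv_mul] at h1 h2
  rw [pderiv_pderiv i j f] at h1
  simp only [smul_eq_mul] at h1 h2
  apply hu.mul_left_cancel
  linear_combination h1 - h2

/-- The `K`-algebra homomorphism `D_n → End_{K[s]}(M)` that describes the action of `D_n`. -/
def weylAct (f : MvPolynomial (Fin n) K) : Weyl n K →ₐ[K] Module.End K[X] (LocRS f) :=
  RingQuot.liftAlgHom K ⟨FreeAlgebra.lift K fun
    | WeylGen.x i => xAct f i
    | WeylGen.d i => dAct f i, by
    intro a b h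
    induction h with
    | dx i j =>
      ext g
      have hX : locPderiv f i (algebraMap (MvPolynomial (Fin n) K[X]) (LocRS f)
          (MvPolynomial.X j)) = if i = j then 1 else 0 := by
        by_cases hij : i = j
        · subst hij; simp [locPderiv]
        · simp [locPderiv, MvPolynomial.pderiv_X_of_ne (Ne.symm hij), hij]
      by_cases hij : i = j
      · subst hij
        rw [if_pos rfl] at hX
        simp [xAct, dAct, hX, Algebra.smul_def]
        ring
      · simp [xAct, dAct, hX, hij, Algebra.smul_def]
        ring
    | xx i j =>
      ext g
      simp [xAct, mul_left_comm]
    | dd i j =>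
      ext g
      simp [dAct, Algebra.smul_def, locPderiv_comm f i j, locPderiv_logDeriv f i j]
      ring⟩

/-- The `K`-algebra homomorphism `D_n[s] → End(M)` that describes the action of `D_n[s]`;
the variable `s` acts as multiplication by `s`. -/
def weylSAct (f : MvPolynomial (Fin n) K) : WeylS n K →ₐ[K] Module.End K[X] (LocRS f) :=
  Polynomial.eval₂AlgHom (weylAct f) (algebraMap K[X] (Module.End K[X] (LocRS f)) X)
    fun P => (Algebra.commutes (A := Module.End K[X] (LocRS f)) (X : K[X]) (weylAct f P)).symm

/-- The free `R_n[s, 1/f]`-module `M = R_n[s, 1/f] · f^s` of rank one on the symbol `f^s`;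
the element `g · f^s` is represented by `g`. -/
def TwistedModule (f : MvPolynomial (Fin n) K) : Type _ := LocRS f

instance (f : MvPolynomial (Fin n) K) : AddCommGroup (TwistedModule f) :=
  inferInstanceAs (AddCommGroup (LocRS f))

instance (f : MvPolynomial (Fin n) K) : Module (LocRS f) (TwistedModule f) :=
  inferInstanceAs (Module (LocRS f) (LocRS f))

/-- The left `D_n[s]`-module structure of `M`, with `P • (g · f^s)` given by `weylSAct`. -/
instance (f : MvPolynomial (Fin n) K) : Module (WeylS n K) (TwistedModule f) :=
  letI : Module (Module.End K[X] (LocRS f)) (TwistedModule f) :=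
    inferInstanceAs (Module (Module.End K[X] (LocRS f)) (LocRS f))
  Module.compHom (TwistedModule f) (weylSAct f).toRingHom

/-- The symbol `f^s`, the generator of `M`. -/
def fs (f : MvPolynomial (Fin n) K) : TwistedModule f := (1 : LocRS f)

theorem smul_def (f : MvPolynomial (Fin n) K) (P : WeylS n K)
    (g : TwistedModule f) :
    P • g = (weylSAct f P (g : LocRS f) : LocRS f) := rfl

/-- The left ideal `ann_{D_n[s]}(f^s)`, that is, `{P ∈ D_n[s] | P • f^s = 0}`. -/
def annFs (f : MvPolynomial (Fin n) K) : Ideal (WeylS n K) :=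
  Ideal.torsionOf (WeylS n K) (TwistedModule f) (fs f)

/-- The left ideal `I_f = ann_{D_n[s]}(f^s) + D_n[s]⟨f⟩`. -/
def annPlus (f : MvPolynomial (Fin n) K) : Ideal (WeylS n K) :=
  annFs f ⊔ Ideal.span {ofPoly f}

/-- `b(s)` satisfies a functional equation `P(s) f · f^s = b(s) · f^s` with `P(s) ∈ D_n[s]`. -/
def HasBernsteinEq (f : MvPolynomial (Fin n) K) (b : K[X]) : Prop :=
  ∃ P : WeylS n K, (P * ofPoly f) • fs f = (ofS b : WeylS n K) • fs f

/-- The left ideal `I_f : (s + α)^i = {P ∈ D_n[s] | P (s + α)^i ∈ I_f}`. -/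
def quotientIdeal (f : MvPolynomial (Fin n) K) (α : K) (i : ℕ) : Ideal (WeylS n K) :=
  (annPlus f).colon {sAdd α ^ i}

open Classical in
/-- The Bernstein–Sato polynomial `b_f(s)`: the monic polynomial of minimal degree among those
that satisfy a functional equation (with the value `0` if there were none). -/
def bernsteinSato (f : MvPolynomial (Fin n) K) : K[X] :=
  if h : {b : K[X] | b.Monic ∧ HasBernsteinEq f b}.Nonempty then
    Polynomial.degree_lt_wf.min {b : K[X] | b.Monic ∧ HasBernsteinEq f b} h
  else 0

end BernsteinSato

end

/-! The elements of `K[s]` lying in `I = annPlus f` form an ideal generated by `b_f`: the equation P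
f · f^s = b · f^s says exactly that b - P f annihilates f^s. Given that b_f is nonzero, the rest is
algebra with the central element t = s + α. Write b_f = t^m c with t not dividing c. If m ≤ i, a
Bézout identity 1 = v t + u c gives (1 - v t) t^i ∈ I, so I : t^i and t together generate the unit
ideal. Conversely, (1 - R t) t^i ∈ I can be iterated to t^i ≡ R^k t^(i+k) modulo I; taking k = m - i
> 0 and multiplying by c would give c t^i ∈ I, hence b_f ∣ c t^i, which is impossible. This is
`colon_pow_sup_span_eq_top_iff`. Setting s = -α amounts to working modulo t, which gives the third
condition (`map_specialize_eq_top_iff`).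

The substantial input is b_f ≠ 0, that is, Bernstein's existence theorem (`exists_hasBernsteinEq`).
Over K(s), filter R_n[s, 1/f] · f^s by pole order and degree; the dimensions grow like k^n.
Bernstein's inequality makes every nonzero subquotient use up a fixed share of that growth, so the
chain of submodules generated by f^j · f^s cannot descend strictly for ever
(`IsWeylPair.exists_mem_succ`). Clearing denominators gives q(s) f^j · f^s ∈ D_n[s] f^(j+1) · f^s
with q ≠ 0, and the substitution s ↦ s - j turns this into a functional equation for f. -/

noncomputable section

namespace BernsteinSato

/-! ### Polynomials: degrees, derivatives, and a count of monomials. -/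

section MvPolynomial

variable {σ R : Type*} [CommRing R]

theorem totalDegree_pderiv_le (i : σ) (p : MvPolynomial σ R) :
    (MvPolynomial.pderiv i p).totalDegree ≤ p.totalDegree - 1 := by
  refine Finset.sup_le fun s hs => ?_
  have hc : MvPolynomial.coeff (s + Finsupp.single i 1) p ≠ 0 := by
    intro h
    rw [MvPolynomial.mem_support_iff, MvPolynomial.coeff_pderiv, h, zero_mul] at hs
    exact hs rfl
  have h := MvPolynomial.le_totalDegree (MvPolynomial.mem_support_iff.mpr hc)
  rw [Finsupp.sum_add_index' (fun _ => rfl) (fun _ _ _ => rfl),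
    Finsupp.sum_single_index rfl] at h
  omega

/-- An exponent s ≠ 0 has some s_i ≠ 0, and the coefficient of ∂_i p at s - e_i is s_i times that of
p at s; characteristic zero allows cancelling s_i. -/
theorem eq_C_of_pderiv_eq_zero [IsDomain R] [CharZero R] (p : MvPolynomial σ R)
    (h : ∀ i, MvPolynomial.pderiv i p = 0) :
    p = MvPolynomial.C (MvPolynomial.coeff 0 p) := by
  classical
  ext s
  rw [MvPolynomial.coeff_C]
  split_ifs with hs
  · rw [hs]
  · obtain ⟨i, hi⟩ : ∃ i, s i ≠ 0 := by
      by_contra! h0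
      exact hs (Finsupp.ext fun i => (h0 i).symm)
    have hc := congrArg (MvPolynomial.coeff (s - Finsupp.single i 1)) (h i)
    rw [MvPolynomial.coeff_pderiv, MvPolynomial.coeff_zero,
      Finsupp.sub_add_single_one_cancel hi] at hc
    rcases mul_eq_zero.mp hc with h1 | h1
    · exact h1
    · exact absurd h1 (Nat.cast_add_one_ne_zero _)

/-- Counts only the monomials whose exponents are all at most m. This crude box has the right order
of growth, and no binomial coefficients are needed. -/
theorem pow_le_finrank_restrictTotalDegree [Nontrivial R] [Fintype σ] (m : ℕ) :
    (m + 1) ^ Fintype.card σ ≤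
      Module.finrank R (MvPolynomial.restrictTotalDegree σ R (Fintype.card σ * m)) := by
  classical
  let e : (σ → Fin (m + 1)) → (σ →₀ ℕ) := fun a => Finsupp.equivFunOnFinite.symm fun i => a i
  have he : Function.Injective e := by
    intro a b hab
    funext i
    exact Fin.ext (DFunLike.congr_fun hab i)
  have hmem : ∀ a, MvPolynomial.monomial (e a) (1 : R) ∈
      MvPolynomial.restrictTotalDegree σ R (Fintype.card σ * m) := by
    intro a
    rw [MvPolynomial.mem_restrictTotalDegree]
    refine (MvPolynomial.totalDegree_monomial_le _ _).trans ?_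
    rw [Finsupp.sum_fintype _ _ (fun _ => rfl)]
    calc ∑ i, e a i ≤ ∑ _i : σ, m := Finset.sum_le_sum fun i _ => Nat.lt_succ_iff.mp (a i).2
      _ = Fintype.card σ * m := by simp
  have hli : LinearIndependent R (fun a => (⟨_, hmem a⟩ :
      MvPolynomial.restrictTotalDegree σ R (Fintype.card σ * m))) := by
    apply LinearIndependent.of_comp (Submodule.subtype _)
    exact (MvPolynomial.basisMonomials σ R).linearIndependent.comp e he
  simpa using hli.fintype_card_le_finrank

end MvPolynomial

/-! ### Normal ordering, Bernstein's inequality, and descending chains. -/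

section Quantization

variable {F V : Type*} [Field F] [AddCommGroup V] [Module F V] {n : ℕ}

/-- Operators `x_i`, `d_i` on a vector space that satisfy the relations of the Weyl algebra. -/
structure IsWeylPair (x d : Fin n → Module.End F V) : Prop where
  x_comm : ∀ i j, x i * x j = x j * x i
  d_comm : ∀ i j, d i * d j = d j * d i
  dx : ∀ i j, d i * x j = x j * d i + if i = j then 1 else 0

variable {x d : Fin n → Module.End F V}

/-- A left and a right multiplication commute by associativity alone. Hence substituting them into a
commutative polynomial makes sense, although `x i` and `d i` do not commute. -/
theorem IsWeylPair.mul_comm_range (h : IsWeylPair x d) :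
    ∀ a ∈ Set.range (Sum.elim (fun i => LinearMap.mulLeft F (x i))
      fun i => LinearMap.mulRight F (d i)),
    ∀ b ∈ Set.range (Sum.elim (fun i => LinearMap.mulLeft F (x i))
      fun i => LinearMap.mulRight F (d i)), a * b = b * a := by
  rintro _ ⟨i | i, rfl⟩ _ ⟨j | j, rfl⟩ <;> ext1 T <;>
    simp only [Sum.elim_inl, Sum.elim_inr, Module.End.mul_apply, LinearMap.mulLeft_apply,
      LinearMap.mulRight_apply]
  · rw [← mul_assoc, ← mul_assoc, h.x_comm]
  · rw [mul_assoc]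
  · rw [mul_assoc]
  · rw [mul_assoc, mul_assoc, h.d_comm]

/-- The normally ordered operator of a polynomial symbol in commuting variables: the variables
`inl i` are replaced by `x_i` and act on the left, the variables `inr i` by `d_i` on the right. -/
def IsWeylPair.normalOrder (h : IsWeylPair x d) :
    MvPolynomial (Fin n ⊕ Fin n) F →ₗ[F] Module.End F V :=
  letI := adjoinCommRing F h.mul_comm_range
  (LinearMap.applyₗ (1 : Module.End F V)).comp
    ((Algebra.adjoin F (Set.range (Sum.elim (fun i => LinearMap.mulLeft F (x i))
      fun i => LinearMap.mulRight F (d i)))).val.comp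
    (MvPolynomial.aeval fun i => ⟨_, Algebra.subset_adjoin ⟨i, rfl⟩⟩)).toLinearMap

namespace IsWeylPair

variable (h : IsWeylPair x d)

theorem normalOrder_C (a : F) : h.normalOrder (MvPolynomial.C a) = a • 1 := by
  simp [normalOrder]

theorem normalOrder_mul_inl (p : MvPolynomial (Fin n ⊕ Fin n) F) (i : Fin n) :
    h.normalOrder (p * MvPolynomial.X (.inl i)) = x i * h.normalOrder p := by
  rw [mul_comm]
  simp [normalOrder]

theorem normalOrder_mul_inr (p : MvPolynomial (Fin n ⊕ Fin n) F) (i : Fin n) :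
    h.normalOrder (p * MvPolynomial.X (.inr i)) = h.normalOrder p * d i := by
  rw [mul_comm]
  simp [normalOrder]

/-- Differentiating the symbol is taking a commutator of operators. This drives the induction on
degree in the faithfulness argument. -/
theorem normalOrder_pderiv_inr (p : MvPolynomial (Fin n ⊕ Fin n) F) (i : Fin n) :
    h.normalOrder (MvPolynomial.pderiv (.inr i) p) =
      h.normalOrder p * x i - x i * h.normalOrder p := by
  induction p using MvPolynomial.induction_on with
  | C a => simp [normalOrder_C]
  | add p q hp hq => rw [map_add, map_add, hp, hq, map_add]; noncomm_ring
  | mul_X p j hp =>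
    rw [MvPolynomial.pderiv_mul, map_add]
    rcases j with j | j
    · rw [MvPolynomial.pderiv_X_of_ne (by simp), mul_zero, map_zero, normalOrder_mul_inl,
        normalOrder_mul_inl, hp, add_zero, mul_sub, ← mul_assoc (x i), h.x_comm i j]
      noncomm_ring
    · rw [normalOrder_mul_inr, normalOrder_mul_inr, hp, mul_assoc _ (d j), h.dx]
      by_cases hij : j = i
      · subst hij
        rw [MvPolynomial.pderiv_X_self, mul_one, if_pos rfl]
        noncomm_ring
      · rw [MvPolynomial.pderiv_X_of_ne (by simpa using hij), mul_zero, map_zero, if_neg hij]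
        noncomm_ring

theorem normalOrder_pderiv_inl (p : MvPolynomial (Fin n ⊕ Fin n) F) (i : Fin n) :
    h.normalOrder (MvPolynomial.pderiv (.inl i) p) =
      d i * h.normalOrder p - h.normalOrder p * d i := by
  induction p using MvPolynomial.induction_on with
  | C a => simp [normalOrder_C]
  | add p q hp hq => rw [map_add, map_add, hp, hq, map_add]; noncomm_ring
  | mul_X p j hp =>
    rw [MvPolynomial.pderiv_mul, map_add]
    rcases j with j | j
    · rw [normalOrder_mul_inl, normalOrder_mul_inl, hp, ← mul_assoc (d i), h.dx]
      by_cases hij : i = j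
      · subst hij
        rw [MvPolynomial.pderiv_X_self, mul_one, if_pos rfl]
        noncomm_ring
      · rw [MvPolynomial.pderiv_X_of_ne (by simpa using Ne.symm hij), mul_zero, map_zero,
          if_neg hij]
        noncomm_ring
    · rw [MvPolynomial.pderiv_X_of_ne (by simp), mul_zero, map_zero, normalOrder_mul_inr,
        normalOrder_mul_inr, hp, add_zero, sub_mul, mul_assoc _ (d i), h.d_comm i j]
      noncomm_ring

end IsWeylPair

/-- An increasing filtration by subspaces that is compatible with operators `x_i` and `d_i` of
order at most one. -/
structure IsFiltered (x d : Fin n → Module.End F V) (G : ℕ → Submodule F V) : Prop where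
  mono : Monotone G
  x_mem : ∀ i k, ∀ v ∈ G k, x i v ∈ G (k + 1)
  d_mem : ∀ i k, ∀ v ∈ G k, d i v ∈ G (k + 1)

/-- Peel off one variable: an `x i` acts last and raises the final level by one, a `d i` acts first
and raises the starting level by one. -/
theorem IsWeylPair.normalOrder_monomial_mem (h : IsWeylPair x d) {G : ℕ → Submodule F V}
    (hG : IsFiltered x d G) (k : ℕ) (e : Fin n ⊕ Fin n →₀ ℕ) (a : F)
    (he : e.degree ≤ k) (j : ℕ) (v : V) (hv : v ∈ G j) :
    h.normalOrder (MvPolynomial.monomial e a) v ∈ G (j + k) := by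
  induction k generalizing e j v with
  | zero =>
    obtain rfl : e = 0 := (Finsupp.degree_eq_zero_iff e).mp (Nat.le_zero.mp he)
    rw [MvPolynomial.monomial_zero', h.normalOrder_C]
    exact (G j).smul_mem a hv
  | succ k ih =>
    by_cases h0 : e = 0
    · subst h0
      rw [MvPolynomial.monomial_zero', h.normalOrder_C]
      exact hG.mono (by omega) ((G j).smul_mem a hv)
    obtain ⟨i, hi⟩ : ∃ i, e i ≠ 0 := by
      by_contra! h1
      exact h0 (Finsupp.ext h1)
    have hd : (e - Finsupp.single i 1).degree ≤ k := by
      have h2 := congrArg Finsupp.degree (Finsupp.sub_add_single_one_cancel hi)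
      rw [map_add, Finsupp.degree_single] at h2
      omega
    have hX : MvPolynomial.monomial e a =
        MvPolynomial.monomial (e - Finsupp.single i 1) a * MvPolynomial.X i := by
      rw [MvPolynomial.X, MvPolynomial.monomial_mul, mul_one,
        Finsupp.sub_add_single_one_cancel hi]
    rw [hX]
    rcases i with i | i
    · rw [h.normalOrder_mul_inl]
      exact hG.x_mem i (j + k) _ (ih _ hd j v hv)
    · rw [h.normalOrder_mul_inr, show j + (k + 1) = j + 1 + k by omega]
      exact ih _ hd (j + 1) _ (hG.d_mem i j v hv)

theorem IsWeylPair.normalOrder_mem (h : IsWeylPair x d) {G : ℕ → Submodule F V}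
    (hG : IsFiltered x d G) (k : ℕ) (p : MvPolynomial (Fin n ⊕ Fin n) F)
    (hp : p.totalDegree ≤ k) (j : ℕ) (v : V) (hv : v ∈ G j) :
    h.normalOrder p v ∈ G (j + k) := by
  rw [p.as_sum, map_sum, LinearMap.sum_apply]
  exact Submodule.sum_mem _ fun e he => h.normalOrder_monomial_mem hG k e _
    ((MvPolynomial.le_totalDegree he).trans hp) j v hv

/-- The faithfulness statement behind the Bernstein inequality. -/
theorem IsWeylPair.eq_zero_of_normalOrder_eq_zero [CharZero F] (h : IsWeylPair x d)
    {G : ℕ → Submodule F V} (hG : IsFiltered x d G) {u : V} (hu : u ∈ G 0) (hu0 : u ≠ 0)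
    (k : ℕ) (p : MvPolynomial (Fin n ⊕ Fin n) F) (hp : p.totalDegree ≤ k)
    (hp0 : ∀ v ∈ G k, h.normalOrder p v = 0) : p = 0 := by
  induction k generalizing p with
  | zero =>
    rw [MvPolynomial.totalDegree_eq_zero_iff_eq_C.mp (Nat.le_zero.mp hp)] at hp0 ⊢
    have h1 := hp0 u hu
    rw [h.normalOrder_C] at h1
    rw [(smul_eq_zero.mp h1).resolve_right hu0, map_zero]
  | succ k ih =>
    -- Each derivative of p has degree at most k and acts as a commutator of p with an operator
    -- sending `G k` into `G (k + 1)`. So it kills `G k` and vanishes by induction. The remaining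
    -- constant kills u ≠ 0.
    have hconst := eq_C_of_pderiv_eq_zero p (by
      intro i
      refine ih _ ((totalDegree_pderiv_le i p).trans (by omega)) fun v hv => ?_
      have h1 := hp0 v (hG.mono (Nat.le_succ k) hv)
      rcases i with i | i
      · rw [h.normalOrder_pderiv_inl]
        simp [h1, hp0 _ (hG.d_mem i k v hv)]
      · rw [h.normalOrder_pderiv_inr]
        simp [h1, hp0 _ (hG.x_mem i k v hv)])
    rw [hconst] at hp0 ⊢
    have h1 := hp0 u (hG.mono (Nat.zero_le _) hu)
    rw [h.normalOrder_C] at h1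
    rw [(smul_eq_zero.mp h1).resolve_right hu0, map_zero]

/-- A form of the Bernstein inequality: the product of the dimensions of two steps of a filtration
of a nonzero module over the Weyl algebra. -/
theorem IsWeylPair.pow_le_finrank_mul_finrank [CharZero F] (h : IsWeylPair x d)
    {G : ℕ → Submodule F V} (hG : IsFiltered x d G) [∀ k, Module.Finite F (G k)]
    {u : V} (hu : u ∈ G 0) (hu0 : u ≠ 0) (m : ℕ) :
    (m + 1) ^ (2 * n) ≤
      Module.finrank F (G (2 * n * m)) * Module.finrank F (G (2 * n * m + 2 * n * m)) := by
  have hcard : Fintype.card (Fin n ⊕ Fin n) = 2 * n := by simp; ring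
  have h1 := pow_le_finrank_restrictTotalDegree (σ := Fin n ⊕ Fin n) (R := F) m
  rw [hcard] at h1
  refine h1.trans ?_
  rw [← Module.finrank_linearMap F F]
  set k := 2 * n * m
  -- Symbols of degree at most k act as linear maps from `G k` to `G (k + k)`, and faithfully so;
  -- the product of dimensions is the dimension of this Hom space.
  let Φ : MvPolynomial.restrictTotalDegree (Fin n ⊕ Fin n) F k →ₗ[F] (G k →ₗ[F] G (k + k)) :=
    { toFun := fun p => (h.normalOrder p.1).restrict fun v hv => h.normalOrder_mem hG k p.1
        ((MvPolynomial.mem_restrictTotalDegree _ _ _).mp p.2) k v hv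
      map_add' := fun p q => by ext v; simp
      map_smul' := fun c p => by ext v; simp }
  apply LinearMap.finrank_le_finrank_of_injective (f := Φ)
  rw [injective_iff_map_eq_zero]
  intro p hp
  apply Subtype.ext
  refine h.eq_zero_of_normalOrder_eq_zero hG hu hu0 k p.1
    ((MvPolynomial.mem_restrictTotalDegree _ _ _).mp p.2) fun v hv => ?_
  exact congrArg Subtype.val (DFunLike.congr_fun hp ⟨v, hv⟩)

theorem finrank_map_mkQ_add_finrank_inf (P N : Submodule F V) [Module.Finite F P] :
    Module.finrank F (P.map N.mkQ) + Module.finrank F (P ⊓ N : Submodule F V) =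
      Module.finrank F P := by
  have h := LinearMap.finrank_range_add_finrank_ker (N.mkQ.domRestrict P)
  rw [LinearMap.range_domRestrict, LinearMap.ker_domRestrict, Submodule.ker_mkQ,
    ← Submodule.finrank_map_subtype_eq, Submodule.map_comap_subtype] at h
  exact h

theorem IsWeylPair.quotient (h : IsWeylPair x d) (N : Submodule F V)
    (hx : ∀ i, N ≤ N.comap (x i)) (hd : ∀ i, N ≤ N.comap (d i)) :
    IsWeylPair (fun i => N.mapQ N (x i) (hx i)) (fun i => N.mapQ N (d i) (hd i)) where
  x_comm i j := by
    ext v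
    simpa using congrArg N.mkQ (DFunLike.congr_fun (h.x_comm i j) v)
  d_comm i j := by
    ext v
    simpa using congrArg N.mkQ (DFunLike.congr_fun (h.d_comm i j) v)
  dx i j := by
    ext v
    have := congrArg N.mkQ (DFunLike.congr_fun (h.dx i j) v)
    split_ifs at this ⊢ <;> simpa using this

/-- The Bernstein inequality for a subquotient `M / N`, with the filtration that `G` induces. -/
theorem IsWeylPair.pow_le_finrank_subquotient [CharZero F] (h : IsWeylPair x d)
    {G : ℕ → Submodule F V} (hG : IsFiltered x d G) [∀ k, Module.Finite F (G k)]
    (M N : Submodule F V) (hxM : ∀ i, M ≤ M.comap (x i)) (hdM : ∀ i, M ≤ M.comap (d i))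
    (hxN : ∀ i, N ≤ N.comap (x i)) (hdN : ∀ i, N ≤ N.comap (d i)) {u : V} {k : ℕ}
    (hu : u ∈ G k) (huM : u ∈ M) (huN : u ∉ N) (m : ℕ) :
    (m + 1) ^ (2 * n) ≤ Module.finrank F ((G (k + 2 * n * m) ⊓ M).map N.mkQ) *
      Module.finrank F (G (k + (2 * n * m + 2 * n * m))) := by
  -- The index is shifted by k so that the class of u lies in level 0.
  have hG' : IsFiltered (fun i => N.mapQ N (x i) (hxN i)) (fun i => N.mapQ N (d i) (hdN i))
      fun l => (G (k + l) ⊓ M).map N.mkQ :=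
    { mono := fun a b hab =>
        Submodule.map_mono (inf_le_inf_right M (hG.mono (Nat.add_le_add_left hab k)))
      x_mem := by
        rintro i l _ ⟨v, ⟨hv, hvM⟩, rfl⟩
        exact ⟨x i v, ⟨hG.x_mem i _ v hv, hxM i hvM⟩, by simp⟩
      d_mem := by
        rintro i l _ ⟨v, ⟨hv, hvM⟩, rfl⟩
        exact ⟨d i v, ⟨hG.d_mem i _ v hv, hdM i hvM⟩, by simp⟩ }
  have hfin : ∀ l, Module.Finite F (G (k + l) ⊓ M : Submodule F V) := fun l =>
    Submodule.finiteDimensional_of_le inf_le_left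
  have := (h.quotient N hxN hdN).pow_le_finrank_mul_finrank hG' (u := N.mkQ u)
    ⟨u, ⟨hu, huM⟩, rfl⟩ (by simpa using huN) m
  -- Only the first factor has to remember the subquotient, since it is the one summed along a
  -- chain; the second is bounded by the whole of `G`.
  refine this.trans (Nat.mul_le_mul_left _ ?_)
  exact (Submodule.finrank_map_le _ _).trans (Submodule.finrank_mono inf_le_left)

/-- Over a field of characteristic zero, a module over the `n`-th Weyl algebra with a filtration
whose dimensions grow at most like `k ^ n` has no strictly descending infinite chains. -/
theorem IsWeylPair.exists_mem_succ [CharZero F] (h : IsWeylPair x d)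
    {G : ℕ → Submodule F V} (hG : IsFiltered x d G) [∀ k, Module.Finite F (G k)]
    (hex : ∀ v, ∃ k, v ∈ G k) (c : ℕ) (hc : ∀ k, Module.finrank F (G k) ≤ c * (k + 1) ^ n)
    (M : ℕ → Submodule F V) (hM : Antitone M) (hxM : ∀ j i, ∀ v ∈ M j, x i v ∈ M j)
    (hdM : ∀ j i, ∀ v ∈ M j, d i v ∈ M j) (u : ℕ → V) (hu : ∀ j, u j ∈ M j) :
    ∃ j, u j ∈ M (j + 1) := by
  by_contra! hne
  obtain ⟨kk, hkk⟩ : ∃ kk : ℕ → ℕ, ∀ j, u j ∈ G (kk j) := ⟨_, fun j => (hex (u j)).choose_spec⟩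
  -- Each strict step uses at least (m + 1)^(2n) of the budget dim G(m + 2nm) · B, where B bounds
  -- dim G(m + 4nm). The growth hypothesis bounds the budget by (L - 1)(m + 1)^(2n), so L strict
  -- steps are too many. L does not depend on m, so m can be chosen afterwards, large enough for `G
  -- m` to contain the first L witnesses.
  set L := (c * (2 * n + 1) ^ n) * (c * (4 * n + 1) ^ n) + 1 with hL
  set m := (Finset.range L).sup kk with hm
  set B := c * (m + (2 * n * m + 2 * n * m) + 1) ^ n with hB
  have hstep : ∀ j < L, (m + 1) ^ (2 * n) +
      Module.finrank F (G (m + 2 * n * m) ⊓ M (j + 1) : Submodule F V) * B ≤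
      Module.finrank F (G (m + 2 * n * m) ⊓ M j : Submodule F V) * B := by
    intro j hj
    have hum : u j ∈ G m := hG.mono (Finset.le_sup (Finset.mem_range.mpr hj)) (hkk j)
    have h1 := h.pow_le_finrank_subquotient hG (M j) (M (j + 1)) (fun i v => hxM _ i v)
      (fun i v => hdM _ i v) (fun i v => hxM _ i v) (fun i v => hdM _ i v) hum (hu j) (hne j) m
    have hfin : Module.Finite F (G (m + 2 * n * m) ⊓ M j : Submodule F V) :=
      Submodule.finiteDimensional_of_le inf_le_left
    have h2 := finrank_map_mkQ_add_finrank_inf (G (m + 2 * n * m) ⊓ M j) (M (j + 1))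
    rw [inf_assoc, inf_eq_right.mpr (hM (Nat.le_succ j))] at h2
    rw [← h2, add_mul]
    exact Nat.add_le_add_right (h1.trans (Nat.mul_le_mul_left _ (hc _))) _
  have hsum : ∀ j ≤ L, j * (m + 1) ^ (2 * n) +
      Module.finrank F (G (m + 2 * n * m) ⊓ M j : Submodule F V) * B ≤
      Module.finrank F (G (m + 2 * n * m)) * B := by
    intro j
    induction j with
    | zero =>
      intro _
      rw [zero_mul, zero_add]
      exact Nat.mul_le_mul_right _ (Submodule.finrank_mono inf_le_left)
    | succ j ih =>
      intro hj
      have h1 := ih (by omega)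
      have h2 := hstep j (by omega)
      rw [add_mul, one_mul]
      omega
  have hA : Module.finrank F (G (m + 2 * n * m)) ≤ c * (2 * n + 1) ^ n * (m + 1) ^ n := by
    refine (hc _).trans ?_
    rw [mul_assoc c, ← mul_pow]
    gcongr
    nlinarith
  have hB' : B ≤ c * (4 * n + 1) ^ n * (m + 1) ^ n := by
    rw [hB, mul_assoc c, ← mul_pow]
    gcongr
    nlinarith
  have hfinal : L * (m + 1) ^ (2 * n) ≤
      (c * (2 * n + 1) ^ n) * (c * (4 * n + 1) ^ n) * (m + 1) ^ (2 * n) := by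
    calc L * (m + 1) ^ (2 * n) ≤ Module.finrank F (G (m + 2 * n * m)) * B :=
          (Nat.le_add_right _ _).trans (hsum L le_rfl)
      _ ≤ (c * (2 * n + 1) ^ n * (m + 1) ^ n) * (c * (4 * n + 1) ^ n * (m + 1) ^ n) :=
          Nat.mul_le_mul hA hB'
      _ = _ := by rw [two_mul n, pow_add]; ring
  have := Nat.le_of_mul_le_mul_right hfinal (by positivity)
  omega

end Quantization

/-! ### The action of D_n[s] and the submodules it generates. -/

section Action

variable {n : ℕ} {K : Type*} [Field K] (f : MvPolynomial (Fin n) K)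

/-- The inclusion `R_n → R_n[s]` as a ring homomorphism. -/
def toRSHom : MvPolynomial (Fin n) K →+* MvPolynomial (Fin n) K[X] := MvPolynomial.map C

theorem toRSHom_apply (g : MvPolynomial (Fin n) K) : toRSHom g = toRS g := rfl

@[simp]
theorem weylAct_xOp (i : Fin n) : weylAct f (xOp i) = xAct f i := by
  simp [weylAct, xOp]

@[simp]
theorem weylAct_dOp (i : Fin n) : weylAct f (dOp i) = dAct f i := by
  simp [weylAct, dOp]

@[simp]
theorem weylSAct_C (P : Weyl n K) : weylSAct f (C P) = weylAct f P :=
  Polynomial.eval₂_C _ _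

@[simp]
theorem weylSAct_X : weylSAct f X = algebraMap K[X] (Module.End K[X] (LocRS f)) X :=
  Polynomial.eval₂_X _ _

theorem weylSAct_ofS (b : K[X]) :
    weylSAct f (ofS b) = algebraMap K[X] (Module.End K[X] (LocRS f)) b := by
  have h : (weylSAct f).comp (ofS (n := n)) =
      (Algebra.ofId K[X] (Module.End K[X] (LocRS f))).restrictScalars K := by
    apply Polynomial.algHom_ext
    simp [ofS, Algebra.ofId_apply]
  exact DFunLike.congr_fun h b

theorem weylAct_polyToWeyl (g : MvPolynomial (Fin n) K) (z : LocRS f) :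
    weylAct f (polyToWeyl g) z = algebraMap (MvPolynomial (Fin n) K[X]) (LocRS f) (toRS g) * z := by
  simp only [← toRSHom_apply]
  induction g using MvPolynomial.induction_on generalizing z with
  | C a =>
    rw [toRSHom, MvPolynomial.map_C, ← MvPolynomial.algebraMap_eq, ← MvPolynomial.algebraMap_eq,
      AlgHom.commutes, AlgHom.commutes, ← IsScalarTower.algebraMap_apply, ← Algebra.smul_def,
      ← Polynomial.algebraMap_eq, Module.algebraMap_end_apply, algebraMap_smul]
  | add p q hp hq =>
    rw [map_add, map_add, LinearMap.add_apply, hp, hq, map_add, map_add, add_mul]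
  | mul_X p i hp =>
    rw [map_mul, map_mul, polyToWeyl_X, weylAct_xOp, Module.End.mul_apply, hp, map_mul,
      map_mul, toRSHom, MvPolynomial.map_X, xAct, LinearMap.mulLeft_apply, mul_assoc]

theorem weylSAct_ofPoly (g : MvPolynomial (Fin n) K) (z : LocRS f) :
    weylSAct f (ofPoly g) z =
      algebraMap (MvPolynomial (Fin n) K[X]) (LocRS f) (toRS g) * z := by
  rw [ofPoly, weylSAct_C, weylAct_polyToWeyl]

theorem dOp_mul_comm (i j : Fin n) : (dOp j * dOp i : Weyl n K) = dOp i * dOp j := by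
  simpa [dOp] using RingQuot.mkAlgHom_rel K (WeylRel.dd (K := K) i j)

theorem dOp_mul_xOp (i j : Fin n) :
    (dOp i * xOp j : Weyl n K) = xOp j * dOp i + if i = j then 1 else 0 := by
  have := RingQuot.mkAlgHom_rel K (WeylRel.dx (K := K) i j)
  split_ifs at this ⊢ <;> simpa [dOp, xOp] using this

theorem xAct_mul_comm (i j : Fin n) : xAct f i * xAct f j = xAct f j * xAct f i := by
  simpa using congrArg (weylAct f) (xOp_mul_comm j i)

theorem dAct_mul_comm (i j : Fin n) : dAct f i * dAct f j = dAct f j * dAct f i := by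
  simpa using congrArg (weylAct f) (dOp_mul_comm j i)

theorem dAct_mul_xAct (i j : Fin n) :
    dAct f i * xAct f j = xAct f j * dAct f i + if i = j then 1 else 0 := by
  have := congrArg (weylAct f) (dOp_mul_xOp i j)
  split_ifs at this ⊢ <;> simpa using this

/-- The Weyl algebra acts on the generic fibre `K(s) ⊗ R_n[s, 1/f] · f^s`. -/
theorem isWeylPair_baseChange : IsWeylPair
    (fun i => (xAct f i).baseChange (FractionRing K[X]))
    (fun i => (dAct f i).baseChange (FractionRing K[X])) where
  x_comm i j := by
    rw [← LinearMap.baseChange_mul, xAct_mul_comm, LinearMap.baseChange_mul]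
  d_comm i j := by
    rw [← LinearMap.baseChange_mul, dAct_mul_comm, LinearMap.baseChange_mul]
  dx i j := by
    rw [← LinearMap.baseChange_mul, dAct_mul_xAct, LinearMap.baseChange_add,
      LinearMap.baseChange_mul]
    split_ifs
    · rw [LinearMap.baseChange_one]
    · rw [LinearMap.baseChange_zero]

/-- The submodule `D_n[s] • g` as a `K[s]`-submodule of `R_n[s, 1/f]`. -/
def orbit (g : LocRS f) : Submodule K[X] (LocRS f) where
  carrier := {z | ∃ P : WeylS n K, weylSAct f P g = z}
  add_mem' := by
    rintro _ _ ⟨P, rfl⟩ ⟨Q, rfl⟩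
    exact ⟨P + Q, by simp⟩
  zero_mem' := ⟨0, by simp⟩
  smul_mem' := by
    rintro c _ ⟨P, rfl⟩
    exact ⟨ofS c * P, by simp [weylSAct_ofS]⟩

theorem weylSAct_mem_orbit {g z : LocRS f} (hz : z ∈ orbit f g) (P : WeylS n K) :
    weylSAct f P z ∈ orbit f g := by
  obtain ⟨Q, rfl⟩ := hz
  exact ⟨P * Q, by simp⟩

theorem orbit_le {g h : LocRS f} (hg : g ∈ orbit f h) : orbit f g ≤ orbit f h := by
  rintro _ ⟨P, rfl⟩
  exact weylSAct_mem_orbit f hg P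

end Action

/-! ### Clearing denominators in the generic fibre. -/

section GenericFibre

variable {R M : Type*} [CommRing R] [IsDomain R] [AddCommGroup M] [Module R M]

theorem exists_smul_eq_of_mem_baseChange (N : Submodule R M)
    {v : TensorProduct R (FractionRing R) M} (hv : v ∈ N.baseChange (FractionRing R)) :
    ∃ q : R, q ≠ 0 ∧ ∃ m ∈ N, q • v = TensorProduct.mk R (FractionRing R) M 1 m := by
  rw [Submodule.baseChange_eq_span] at hv
  induction hv using Submodule.span_induction with
  | mem v hv =>
    obtain ⟨m, hm, rfl⟩ := hv
    exact ⟨1, one_ne_zero, m, hm, one_smul _ _⟩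
  | zero => exact ⟨1, one_ne_zero, 0, N.zero_mem, by simp⟩
  | add v w _ _ hv hw =>
    obtain ⟨q, hq, m, hm, h1⟩ := hv
    obtain ⟨r, hr, l, hl, h2⟩ := hw
    refine ⟨q * r, mul_ne_zero hq hr, r • m + q • l,
      N.add_mem (N.smul_mem _ hm) (N.smul_mem _ hl), ?_⟩
    rw [map_add, map_smul, map_smul, ← h1, ← h2, smul_add, smul_smul, smul_smul, mul_comm q r]
  | smul a v _ hv =>
    obtain ⟨q, hq, m, hm, h1⟩ := hv
    obtain ⟨⟨r, s⟩, hrs⟩ := IsLocalization.surj (nonZeroDivisors R) a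
    refine ⟨s * q, mul_ne_zero (nonZeroDivisors.ne_zero s.2) hq, r • m, N.smul_mem _ hm, ?_⟩
    rw [map_smul, ← h1, ← algebraMap_smul (FractionRing R) ((s : R) * q), smul_smul, map_mul,
      mul_right_comm, mul_comm _ a, hrs, mul_smul, algebraMap_smul, algebraMap_smul]

/-- Torsion-freeness makes M embed in its generic fibre, so an equality there, once denominators are
cleared, already holds in M. -/
theorem exists_smul_mem_of_mk_mem_baseChange [Module.IsTorsionFree R M] (N : Submodule R M) {m : M}
    (hm : TensorProduct.mk R (FractionRing R) M 1 m ∈ N.baseChange (FractionRing R)) :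
    ∃ q : R, q ≠ 0 ∧ q • m ∈ N := by
  obtain ⟨q, hq, l, hl, h⟩ := exists_smul_eq_of_mem_baseChange N hm
  rw [← map_smul, IsLocalizedModule.eq_iff_exists (nonZeroDivisors R)] at h
  obtain ⟨c, hc⟩ := h
  have hc0 : (c : R) ≠ 0 := nonZeroDivisors.ne_zero c.2
  have : q • m = l := smul_right_injective M hc0 hc
  exact ⟨q, hq, this ▸ hl⟩

end GenericFibre

/-! ### Base change of invariant submodules. -/

section BaseChange

variable {R M : Type*} [CommRing R] [AddCommGroup M] [Module R M] (A : Type*) [CommRing A]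
  [Algebra R A]

theorem baseChange_mono {N P : Submodule R M} (h : N ≤ P) : N.baseChange A ≤ P.baseChange A := by
  rw [Submodule.baseChange_eq_span, Submodule.baseChange_eq_span]
  exact Submodule.span_mono (Submodule.map_mono h)

theorem baseChange_le_comap {N : Submodule R M} {φ : Module.End R M} (h : N ≤ N.comap φ) :
    N.baseChange A ≤ (N.baseChange A).comap (φ.baseChange A) := by
  nth_rw 1 [Submodule.baseChange_eq_span]
  refine Submodule.span_le.mpr ?_
  rintro _ ⟨m, hm, rfl⟩
  exact Submodule.tmul_mem_baseChange_of_mem 1 (h hm)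

end BaseChange

/-! ### The filtration by pole order and degree. -/

section Filtration

variable {n : ℕ} {K : Type*} [Field K] (f : MvPolynomial (Fin n) K)

theorem algebraMap_smul_locRS (c : K[X]) (g : MvPolynomial (Fin n) K[X]) :
    algebraMap (MvPolynomial (Fin n) K[X]) (LocRS f) (c • g) =
      c • algebraMap (MvPolynomial (Fin n) K[X]) (LocRS f) g := by
  rw [Algebra.smul_def, map_mul, ← IsScalarTower.algebraMap_apply, ← Algebra.smul_def]

/-- `f` as an element of `R_n[s, 1/f]`. -/
def locF : LocRS f := algebraMap (MvPolynomial (Fin n) K[X]) (LocRS f) (toRS f)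

theorem isUnit_locF : IsUnit (locF f) := IsLocalization.Away.algebraMap_isUnit (toRS f)

theorem dAct_apply (i : Fin n) (z : LocRS f) :
    dAct f i z = locPderiv f i z + (X : K[X]) • (logDeriv f i * z) := rfl

theorem xAct_apply (i : Fin n) (z : LocRS f) :
    xAct f i z = algebraMap (MvPolynomial (Fin n) K[X]) (LocRS f) (MvPolynomial.X i) * z := rfl

theorem locF_mul_logDeriv (i : Fin n) :
    locF f * logDeriv f i = algebraMap (MvPolynomial (Fin n) K[X]) (LocRS f)
      (MvPolynomial.pderiv i (toRS f)) := by
  rw [mul_comm, locF, logDeriv_mul]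
  exact congrArg _ MvPolynomial.pderiv_map.symm

theorem locPderiv_locF_pow (i : Fin n) (k : ℕ) :
    locPderiv f i (locF f ^ k) = (k : LocRS f) * (locF f ^ k * logDeriv f i) := by
  have h1 : locPderiv f i (locF f) = locF f * logDeriv f i := by
    rw [locF_mul_logDeriv, locF, locPderiv, locDerivation_algebraMap]
  induction k with
  | zero => simp
  | succ k ih =>
    rw [pow_succ, Derivation.leibniz, ih, h1]
    simp only [smul_eq_mul]
    push_cast
    ring

theorem exists_locF_pow_mul_eq (z : LocRS f) : ∃ (k : ℕ) (g : MvPolynomial (Fin n) K[X]),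
    locF f ^ k * z = algebraMap (MvPolynomial (Fin n) K[X]) (LocRS f) g := by
  obtain ⟨k, g, hg⟩ := IsLocalization.Away.surj (toRS f) z
  exact ⟨k, g, by rw [mul_comm, locF, ← hg]⟩

/-- The elements `g / f^k` of `R_n[s, 1/f]` with `deg g ≤ k (deg f + 1)`, where `deg` is the total
degree in `x_1, …, x_n`. -/
def poleSet (k : ℕ) : Set (LocRS f) :=
  {z | ∃ g : MvPolynomial (Fin n) K[X], g.totalDegree ≤ k * ((toRS f).totalDegree + 1) ∧
    locF f ^ k * z = algebraMap (MvPolynomial (Fin n) K[X]) (LocRS f) g}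

theorem poleSet_mono : Monotone (poleSet f) := by
  refine monotone_nat_of_le_succ fun k => ?_
  rintro z ⟨g, hg, hz⟩
  refine ⟨toRS f * g, ?_, ?_⟩
  · have := MvPolynomial.totalDegree_mul (toRS f) g
    rw [add_mul]
    omega
  · rw [map_mul, ← hz, pow_succ', mul_assoc, locF]

theorem xAct_mem_poleSet (i : Fin n) (k : ℕ) {z : LocRS f} (hz : z ∈ poleSet f k) :
    xAct f i z ∈ poleSet f (k + 1) := by
  obtain ⟨g, hg, hz⟩ := hz
  -- One more pole costs a factor f in the numerator, and x_i adds one to its degree; this is the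
  -- reason for deg f + 1 in `poleSet`.
  refine ⟨MvPolynomial.X i * (toRS f * g), ?_, ?_⟩
  · have h1 := MvPolynomial.totalDegree_mul (toRS f) g
    have h2 := MvPolynomial.totalDegree_mul (MvPolynomial.X i : MvPolynomial (Fin n) K[X])
      (toRS f * g)
    rw [MvPolynomial.totalDegree_X] at h2
    rw [add_mul]
    omega
  · rw [map_mul, map_mul, ← hz, xAct_apply, locF]
    ring

theorem dAct_mem_poleSet (i : Fin n) (k : ℕ) {z : LocRS f} (hz : z ∈ poleSet f k) :
    dAct f i z ∈ poleSet f (k + 1) := by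
  obtain ⟨g, hg, hz⟩ := hz
  -- The quotient rule: ∂_i (g f^(-k) · f^s) = (f ∂_i g + (s - k) g ∂_i f) f^(-k-1) · f^s.
  refine ⟨toRS f * MvPolynomial.pderiv i g +
    (X - C (k : K) : K[X]) • (MvPolynomial.pderiv i (toRS f) * g), ?_, ?_⟩
  · have h1 := MvPolynomial.totalDegree_mul (toRS f) (MvPolynomial.pderiv i g)
    have h2 := MvPolynomial.totalDegree_mul (MvPolynomial.pderiv i (toRS f)) g
    have h3 := totalDegree_pderiv_le i g
    have h4 := totalDegree_pderiv_le i (toRS f)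
    have h5 := MvPolynomial.totalDegree_smul_le (X - C (k : K) : K[X])
      (MvPolynomial.pderiv i (toRS f) * g)
    refine (MvPolynomial.totalDegree_add _ _).trans ?_
    rw [add_mul]
    exact max_le (by omega) (by omega)
  · have hd : locPderiv f i (locF f ^ k * z) =
        algebraMap (MvPolynomial (Fin n) K[X]) (LocRS f) (MvPolynomial.pderiv i g) := by
      rw [hz, locPderiv, locDerivation_algebraMap]
    rw [Derivation.leibniz, locPderiv_locF_pow] at hd
    rw [dAct_apply, map_add, map_mul, ← hd, algebraMap_smul_locRS, map_mul, ← hz,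
      ← locF_mul_logDeriv, ← locF]
    simp only [smul_eq_mul, Algebra.smul_def, map_natCast, map_sub]
    ring

theorem exists_mem_poleSet (z : LocRS f) : ∃ k, z ∈ poleSet f k := by
  obtain ⟨k, g, hz⟩ := exists_locF_pow_mul_eq f z
  -- Each extra factor f raises the numerator's degree by at most deg f but the allowance by deg f +
  -- 1, so deg g extra factors absorb the degree of g.
  refine ⟨k + g.totalDegree, toRS f ^ g.totalDegree * g, ?_, ?_⟩
  · have h1 := MvPolynomial.totalDegree_mul (toRS f ^ g.totalDegree) g
    have h2 := MvPolynomial.totalDegree_pow (toRS f) g.totalDegree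
    nlinarith [Nat.zero_le (k * ((toRS f).totalDegree + 1))]
  · rw [map_mul, map_pow, ← hz, ← locF, pow_add]
    ring

/-- The filtration of `K(s) ⊗ R_n[s, 1/f] · f^s` by pole order and degree. -/
def poleFiltration (k : ℕ) :
    Submodule (FractionRing K[X]) (TensorProduct K[X] (FractionRing K[X]) (LocRS f)) :=
  Submodule.span _ (TensorProduct.mk K[X] (FractionRing K[X]) (LocRS f) 1 '' poleSet f k)

theorem mk_mem_poleFiltration {k : ℕ} {z : LocRS f} (hz : z ∈ poleSet f k) :
    TensorProduct.mk K[X] (FractionRing K[X]) (LocRS f) 1 z ∈ poleFiltration f k :=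
  Submodule.subset_span ⟨z, hz, rfl⟩

theorem isFiltered_poleFiltration : IsFiltered
    (fun i => (xAct f i).baseChange (FractionRing K[X]))
    (fun i => (dAct f i).baseChange (FractionRing K[X])) (poleFiltration f) where
  mono a b hab := Submodule.span_mono (Set.image_mono (poleSet_mono f hab))
  x_mem i k := by
    suffices h : poleFiltration f k ≤
        (poleFiltration f (k + 1)).comap ((xAct f i).baseChange (FractionRing K[X])) from
      fun v hv => h hv
    refine Submodule.span_le.mpr ?_
    rintro _ ⟨z, hz, rfl⟩
    exact mk_mem_poleFiltration f (xAct_mem_poleSet f i k hz)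
  d_mem i k := by
    suffices h : poleFiltration f k ≤
        (poleFiltration f (k + 1)).comap ((dAct f i).baseChange (FractionRing K[X])) from
      fun v hv => h hv
    refine Submodule.span_le.mpr ?_
    rintro _ ⟨z, hz, rfl⟩
    exact mk_mem_poleFiltration f (dAct_mem_poleSet f i k hz)

theorem exists_mem_poleFiltration (v : TensorProduct K[X] (FractionRing K[X]) (LocRS f)) :
    ∃ k, v ∈ poleFiltration f k := by
  have hmono := (isFiltered_poleFiltration f).mono
  induction v using TensorProduct.induction_on with
  | zero => exact ⟨0, Submodule.zero_mem _⟩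
  | tmul a z =>
    obtain ⟨k, hk⟩ := exists_mem_poleSet f z
    refine ⟨k, ?_⟩
    have := (poleFiltration f k).smul_mem a (mk_mem_poleFiltration f hk)
    simpa [TensorProduct.smul_tmul'] using this
  | add v w hv hw =>
    obtain ⟨k, hk⟩ := hv
    obtain ⟨l, hl⟩ := hw
    exact ⟨max k l, Submodule.add_mem _ (hmono (le_max_left _ _) hk) (hmono (le_max_right _ _) hl)⟩

/-- The image of the monomial with the given exponents, divided by `f^k`. -/
def poleMonomial (k N : ℕ) (a : Fin n → Fin (N + 1)) :
    TensorProduct K[X] (FractionRing K[X]) (LocRS f) :=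
  TensorProduct.mk K[X] (FractionRing K[X]) (LocRS f) 1 (invf f ^ k *
    algebraMap (MvPolynomial (Fin n) K[X]) (LocRS f)
      (MvPolynomial.monomial (Finsupp.equivFunOnFinite.symm fun i => (a i : ℕ)) 1))

/-- Bounding each exponent separately by the total degree leaves a box of (k (deg f + 1) + 1)^n
monomials, which has the required growth k^n. -/
theorem poleFiltration_le (k : ℕ) : poleFiltration f k ≤ Submodule.span (FractionRing K[X])
    (Set.range (poleMonomial f k (k * ((toRS f).totalDegree + 1)))) := by
  refine Submodule.span_le.mpr ?_
  rintro _ ⟨z, ⟨g, hg, hz⟩, rfl⟩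
  have hinv : invf f ^ k * locF f ^ k = 1 := by
    rw [← mul_pow, mul_comm, invf, locF, IsLocalization.Away.mul_invSelf, one_pow]
  have hz' : z = invf f ^ k * algebraMap (MvPolynomial (Fin n) K[X]) (LocRS f) g := by
    rw [← hz, ← mul_assoc, hinv, one_mul]
  rw [hz', g.as_sum, map_sum, Finset.mul_sum, map_sum]
  refine Submodule.sum_mem _ fun e he => ?_
  have hmon : MvPolynomial.monomial e (MvPolynomial.coeff e g) =
      MvPolynomial.coeff e g • MvPolynomial.monomial e (1 : K[X]) := by
    rw [MvPolynomial.smul_monomial, smul_eq_mul, mul_one]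
  rw [hmon, algebraMap_smul_locRS, mul_smul_comm, map_smul,
    ← algebraMap_smul (FractionRing K[X]) (MvPolynomial.coeff e g)]
  have hle : ∀ i, e i < k * ((toRS f).totalDegree + 1) + 1 := fun i =>
    Nat.lt_succ_of_le (((Finsupp.le_degree i e).trans (MvPolynomial.le_totalDegree he)).trans hg)
  refine Submodule.smul_mem _ _ (Submodule.subset_span ⟨fun i => ⟨e i, hle i⟩, ?_⟩)
  have he' : (Finsupp.equivFunOnFinite.symm fun i =>
      ((⟨e i, hle i⟩ : Fin (k * ((toRS f).totalDegree + 1) + 1)) : ℕ)) = e :=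
    Finsupp.ext fun _ => rfl
  rw [poleMonomial, he']

instance finite_poleFiltration (k : ℕ) : Module.Finite (FractionRing K[X]) (poleFiltration f k) :=
  have := FiniteDimensional.span_of_finite (FractionRing K[X])
    (Set.finite_range (poleMonomial f k (k * ((toRS f).totalDegree + 1))))
  Submodule.finiteDimensional_of_le (poleFiltration_le f k)

theorem finrank_poleFiltration_le (k : ℕ) :
    Module.finrank (FractionRing K[X]) (poleFiltration f k) ≤
    ((toRS f).totalDegree + 1) ^ n * (k + 1) ^ n := by
  have := FiniteDimensional.span_of_finite (FractionRing K[X])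
    (Set.finite_range (poleMonomial f k (k * ((toRS f).totalDegree + 1))))
  refine (Submodule.finrank_mono (poleFiltration_le f k)).trans
    ((finrank_range_le_card _).trans ?_)
  rw [Fintype.card_fun, Fintype.card_fin, Fintype.card_fin, ← mul_pow]
  gcongr
  nlinarith

variable {f}

theorem toRS_ne_zero (hf : f ≠ 0) : toRS f ≠ 0 := fun h =>
  hf (MvPolynomial.map_injective C C_injective (h.trans (map_zero _).symm))

theorem isDomain_locRS (hf : f ≠ 0) : IsDomain (LocRS f) :=
  IsLocalization.isDomain_localization (powers_le_nonZeroDivisors_of_noZeroDivisors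
    (toRS_ne_zero hf))

theorem algebraMap_injective (hf : f ≠ 0) :
    Function.Injective (algebraMap (MvPolynomial (Fin n) K[X]) (LocRS f)) :=
  IsLocalization.injective _ (powers_le_nonZeroDivisors_of_noZeroDivisors (toRS_ne_zero hf))

theorem isTorsionFree_locRS (hf : f ≠ 0) : Module.IsTorsionFree K[X] (LocRS f) := by
  have := isDomain_locRS hf
  have : FaithfulSMul K[X] (LocRS f) := by
    rw [faithfulSMul_iff_algebraMap_injective, IsScalarTower.algebraMap_eq K[X]
      (MvPolynomial (Fin n) K[X]) (LocRS f)]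
    exact (algebraMap_injective hf).comp (MvPolynomial.C_injective _ _)
  infer_instance

/-- Over K(s) the chain of submodules generated by f^j · f^s stops descending strictly at some j;
the factor q clears the denominators of the resulting membership. -/
theorem exists_smul_locF_pow_mem_orbit [CharZero K] (hf : f ≠ 0) :
    ∃ (j : ℕ) (q : K[X]), q ≠ 0 ∧ q • locF f ^ j ∈ orbit f (locF f ^ (j + 1)) := by
  have := isTorsionFree_locRS hf
  have : CharZero (FractionRing K[X]) := charZero_of_injective_algebraMap
    (IsFractionRing.injective K[X] (FractionRing K[X]))
  obtain ⟨j, hj⟩ := (isWeylPair_baseChange f).exists_mem_succ (isFiltered_poleFiltration f)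
    (exists_mem_poleFiltration f) _ (finrank_poleFiltration_le f)
    (fun j => (orbit f (locF f ^ j)).baseChange (FractionRing K[X]))
    (antitone_nat_of_succ_le fun j => baseChange_mono _ (orbit_le f (g := locF f ^ (j + 1))
      ⟨ofPoly f, by rw [weylSAct_ofPoly, ← locF, pow_succ']⟩))
    (fun j i _ hv => baseChange_le_comap _ (fun z hz => by
      simpa using weylSAct_mem_orbit f hz (C (xOp i))) hv)
    (fun j i _ hv => baseChange_le_comap _ (fun z hz => by
      simpa using weylSAct_mem_orbit f hz (C (dOp i))) hv)
    (fun j => TensorProduct.mk K[X] (FractionRing K[X]) (LocRS f) 1 (locF f ^ j))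
    (fun j => Submodule.tmul_mem_baseChange_of_mem 1 ⟨1, by simp⟩)
  exact ⟨j, exists_smul_mem_of_mk_mem_baseChange _ hj⟩

end Filtration

/-- The equation says that b - P a annihilates m. Only the semiring structure of A enters the
statement; the subtraction comes from the scalar -1 ∈ K. -/
theorem exists_mul_smul_eq_iff_mem_sup (K : Type*) {A M : Type*} [CommRing K] [Semiring A]
    [Algebra K A] [AddCommGroup M] [Module A M] (m : M) (a b : A) :
    (∃ P : A, (P * a) • m = b • m) ↔ b ∈ Ideal.torsionOf A M m ⊔ Ideal.span {a} := by
  let : Ring A := Algebra.semiringToRing K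
  rw [sup_comm, Ideal.mem_span_singleton_sup]
  constructor
  · rintro ⟨P, hP⟩
    refine ⟨P, b - P * a, ?_, by abel⟩
    rw [Ideal.mem_torsionOf_iff, sub_smul, hP, sub_self]
  · rintro ⟨P, Q, hQ, h⟩
    refine ⟨P, ?_⟩
    rw [Ideal.mem_torsionOf_iff] at hQ
    rw [← h, add_smul, hQ, add_zero]

/-! ### The substitution s ↦ s - k and the existence of a functional equation. -/

section Shift

variable {n : ℕ} {K : Type*} [Field K] (f : MvPolynomial (Fin n) K) (k : ℕ)

/-- The substitution `s ↦ s - k` on `K[s]`. -/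
def shiftS : K[X] →+* K[X] := compRingHom (X - C (k : K))

theorem shiftS_C (a : K) : shiftS k (C a) = C a := by simp [shiftS]

theorem shiftS_X : shiftS k (X : K[X]) = X - C (k : K) := by simp [shiftS]

theorem map_shiftS_toRS (g : MvPolynomial (Fin n) K) :
    MvPolynomial.map (shiftS k) (toRS g) = toRS g := by
  have h : (shiftS k : K[X] →+* K[X]).comp C = C := RingHom.ext (shiftS_C k)
  rw [toRS, MvPolynomial.map_map, h]

/-- The substitution `s ↦ s - k` on `R_n[s, 1/f]`. -/
def shiftLoc : LocRS f →+* LocRS f :=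
  IsLocalization.Away.lift (toRS f)
    (g := (algebraMap (MvPolynomial (Fin n) K[X]) (LocRS f)).comp (MvPolynomial.map (shiftS k)))
    (by
      rw [RingHom.comp_apply, map_shiftS_toRS]
      exact isUnit_locF f)

theorem shiftLoc_algebraMap (g : MvPolynomial (Fin n) K[X]) :
    shiftLoc f k (algebraMap (MvPolynomial (Fin n) K[X]) (LocRS f) g) =
      algebraMap (MvPolynomial (Fin n) K[X]) (LocRS f) (MvPolynomial.map (shiftS k) g) :=
  IsLocalization.Away.lift_eq (toRS f) _ g

theorem shiftLoc_toRS (g : MvPolynomial (Fin n) K) :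
    shiftLoc f k (algebraMap (MvPolynomial (Fin n) K[X]) (LocRS f) (toRS g)) =
      algebraMap (MvPolynomial (Fin n) K[X]) (LocRS f) (toRS g) := by
  rw [shiftLoc_algebraMap, map_shiftS_toRS]

theorem shiftLoc_locF : shiftLoc f k (locF f) = locF f := shiftLoc_toRS f k f

theorem shiftLoc_smul (c : K[X]) (z : LocRS f) :
    shiftLoc f k (c • z) = shiftS k c • shiftLoc f k z := by
  rw [Algebra.smul_def, map_mul, IsScalarTower.algebraMap_apply K[X] (MvPolynomial (Fin n) K[X]),
    shiftLoc_algebraMap, MvPolynomial.algebraMap_eq, MvPolynomial.map_C, Algebra.smul_def,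
    IsScalarTower.algebraMap_apply K[X] (MvPolynomial (Fin n) K[X]), MvPolynomial.algebraMap_eq]

theorem shiftLoc_logDeriv (i : Fin n) : shiftLoc f k (logDeriv f i) = logDeriv f i := by
  apply (isUnit_locF f).mul_right_cancel
  conv_lhs => rw [← shiftLoc_locF f k]
  rw [← map_mul, locF, logDeriv_mul, shiftLoc_toRS]

theorem locPderiv_algebraMap (i : Fin n) (g : MvPolynomial (Fin n) K[X]) :
    locPderiv f i (algebraMap (MvPolynomial (Fin n) K[X]) (LocRS f) g) =
      algebraMap (MvPolynomial (Fin n) K[X]) (LocRS f) (MvPolynomial.pderiv i g) :=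
  locDerivation_algebraMap _ _ g

/-- The substitution touches only s and the derivation only the x_i. They commute on polynomials,
and the Leibniz rule for f^m z carries this over to fractions. -/
theorem shiftLoc_locPderiv (i : Fin n) (z : LocRS f) :
    shiftLoc f k (locPderiv f i z) = locPderiv f i (shiftLoc f k z) := by
  obtain ⟨m, g, hz⟩ := exists_locF_pow_mul_eq f z
  have h1 := congrArg (fun w => shiftLoc f k (locPderiv f i w)) hz
  have h2 := congrArg (fun w => locPderiv f i (shiftLoc f k w)) hz
  simp only [locPderiv_algebraMap, shiftLoc_algebraMap, MvPolynomial.pderiv_map] at h1 h2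
  rw [← h1] at h2
  simp only [map_mul, map_pow, Derivation.leibniz, shiftLoc_locF, smul_eq_mul,
    map_add, locPderiv_locF_pow, map_natCast, shiftLoc_logDeriv] at h2
  apply ((isUnit_locF f).pow m).mul_left_cancel
  linear_combination -h2

/-- `P'` is the image of `P` under `s ↦ s - k`: it corresponds to `P` under the semilinear map
`g(s) · f^s ↦ g(s - k) · f^{s - k}`. -/
def IsShift (P P' : WeylS n K) : Prop :=
  ∀ z w : LocRS f, locF f ^ k * w = shiftLoc f k z →
    locF f ^ k * weylSAct f P' w = shiftLoc f k (weylSAct f P z)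

variable {f k}

theorem IsShift.add {P P' Q Q' : WeylS n K} (hP : IsShift f k P P') (hQ : IsShift f k Q Q') :
    IsShift f k (P + Q) (P' + Q') := by
  intro z w h
  simp [mul_add, hP z w h, hQ z w h]

theorem IsShift.mul {P P' Q Q' : WeylS n K} (hP : IsShift f k P P') (hQ : IsShift f k Q Q') :
    IsShift f k (P * Q) (P' * Q') := by
  intro z w h
  simp only [map_mul, Module.End.mul_apply]
  exact hP _ _ (hQ z w h)

variable (f k)

theorem isShift_C_algebraMap (a : K) :
    IsShift f k (C (algebraMap K _ a)) (C (algebraMap K _ a)) := by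
  have h1 : ∀ z : LocRS f, weylSAct f (C (algebraMap K _ a)) z = (C a : K[X]) • z := by
    intro z
    rw [weylSAct_C, AlgHom.commutes, Module.algebraMap_end_apply, ← Polynomial.algebraMap_eq,
      algebraMap_smul]
  intro z w h
  rw [h1, h1, shiftLoc_smul, shiftS_C, mul_smul_comm, h]

theorem isShift_X : IsShift f k X (X + C (algebraMap K _ (-(k : K)))) := by
  intro z w h
  rw [map_add, weylSAct_X, weylSAct_C, AlgHom.commutes, LinearMap.add_apply,
    Module.algebraMap_end_apply, Module.algebraMap_end_apply, Module.algebraMap_end_apply,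
    shiftLoc_smul, shiftS_X, sub_smul, ← h, mul_add, mul_smul_comm, mul_smul_comm,
    ← Polynomial.algebraMap_eq, algebraMap_smul, neg_smul, sub_eq_add_neg]

theorem isShift_xOp (i : Fin n) : IsShift f k (C (xOp i)) (C (xOp i)) := by
  intro z w h
  rw [weylSAct_C, weylAct_xOp, xAct_apply, xAct_apply, map_mul, ← h, shiftLoc_algebraMap,
    MvPolynomial.map_X, mul_left_comm]

/-- The term k f^k (∂_i f / f) w produced by differentiating f^k cancels the -k coming from s ↦ s -
k. -/
theorem isShift_dOp (i : Fin n) : IsShift f k (C (dOp i)) (C (dOp i)) := by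
  intro z w h
  rw [weylSAct_C, weylAct_dOp, dAct_apply, dAct_apply, map_add, shiftLoc_locPderiv, shiftLoc_smul,
    map_mul, shiftLoc_logDeriv, shiftS_X, ← h, Derivation.leibniz, locPderiv_locF_pow]
  simp only [smul_eq_mul, Algebra.smul_def, map_sub, map_natCast]
  ring

/-- Only the existence of a shifted operator is needed, so the relation is propagated from the
generators through sums and products, without constructing an automorphism of D_n[s]. -/
theorem exists_isShift_C (P : Weyl n K) : ∃ P', IsShift f k (C P) P' := by
  obtain ⟨P, rfl⟩ := RingQuot.mkAlgHom_surjective K (WeylRel n K) P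
  induction P using FreeAlgebra.induction with
  | grade0 a => exact ⟨_, by rw [AlgHom.commutes]; exact isShift_C_algebraMap f k a⟩
  | grade1 x =>
    rcases x with i | i
    · exact ⟨_, isShift_xOp f k i⟩
    · exact ⟨_, isShift_dOp f k i⟩
  | mul P Q hP hQ =>
    obtain ⟨P', hP⟩ := hP
    obtain ⟨Q', hQ⟩ := hQ
    exact ⟨_, by rw [map_mul, map_mul]; exact hP.mul hQ⟩
  | add P Q hP hQ =>
    obtain ⟨P', hP⟩ := hP
    obtain ⟨Q', hQ⟩ := hQ
    exact ⟨_, by rw [map_add, map_add]; exact hP.add hQ⟩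

theorem exists_isShift (P : WeylS n K) : ∃ P', IsShift f k P P' := by
  induction P using Polynomial.induction_on with
  | C a => exact exists_isShift_C f k a
  | add P Q hP hQ =>
    obtain ⟨P', hP⟩ := hP
    obtain ⟨Q', hQ⟩ := hQ
    exact ⟨_, hP.add hQ⟩
  | monomial m a h =>
    obtain ⟨P', hP⟩ := h
    exact ⟨_, by rw [pow_succ, ← mul_assoc]; exact hP.mul (isShift_X f k)⟩

theorem hasBernsteinEq_iff_mem_annPlus (b : K[X]) :
    HasBernsteinEq f b ↔ (ofS b : WeylS n K) ∈ annPlus f :=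
  exists_mul_smul_eq_iff_mem_sup K (fs f) (ofPoly f) (ofS b)

variable {f}

/-- The existence of a nonzero polynomial that satisfies a Bernstein functional equation. -/
theorem exists_hasBernsteinEq [CharZero K] (hf : f ≠ 0) :
    ∃ b : K[X], b ≠ 0 ∧ HasBernsteinEq f b := by
  obtain ⟨j, q, hq, P, hP⟩ := exists_smul_locF_pow_mem_orbit hf
  obtain ⟨P', hP'⟩ := exists_isShift f j P
  -- After shifting, f^(j+1) · f^(s-j) is f · f^s and f^j · f^(s-j) is f^s, so the relation for q
  -- becomes P' f · f^s = q(s - j) · f^s once the unit f^j is cancelled.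
  have h1 := hP' (locF f ^ (j + 1)) (locF f) (by rw [map_pow, shiftLoc_locF, pow_succ])
  rw [hP, shiftLoc_smul, map_pow, shiftLoc_locF, ← mul_one (locF f ^ j), ← mul_smul_comm,
    mul_one] at h1
  refine ⟨shiftS j q, ?_, P', ?_⟩
  · intro h0
    rw [shiftS, coe_compRingHom_apply, comp_eq_zero_iff] at h0
    rcases h0 with h0 | ⟨-, h0⟩
    · exact hq h0
    · have := natDegree_X_sub_C (j : K)
      rw [h0, natDegree_C] at this
      exact zero_ne_one this
  · have h2 : weylSAct f (P' * ofPoly f) 1 = weylSAct f (ofS (shiftS j q)) 1 := by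
      rw [map_mul, Module.End.mul_apply, weylSAct_ofS, weylSAct_ofPoly, mul_one]
      exact ((isUnit_locF f).pow j).mul_left_cancel h1
    exact h2

end Shift

/-! ### Colon ideals by powers of a central element. -/

section CentralSubalgebra

variable {K B : Type*} [Field K] [Semiring B] [Algebra K B]

/-- The element of J is 1 - R t, written with the scalar -1 because B is only assumed to be a
semiring. -/
theorem sup_span_singleton_eq_top_iff (J : Ideal B) (t : B) :
    J ⊔ Ideal.span {t} = ⊤ ↔ ∃ R, 1 + algebraMap K B (-1) * (R * t) ∈ J := by
  let : Ring B := Algebra.semiringToRing K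
  simp only [map_neg, map_one, neg_one_mul, ← sub_eq_add_neg]
  rw [Ideal.eq_top_iff_one, sup_comm, Ideal.mem_span_singleton_sup]
  constructor
  · rintro ⟨R, x, hx, h⟩
    exact ⟨R, by rwa [← h, add_sub_cancel_left]⟩
  · rintro ⟨R, h⟩
    exact ⟨R, _, h, by abel⟩

/-- The algebraic core: I is only a left ideal, but φ has central image, so powers of t = φ(X - β)
can be moved past R. -/
theorem colon_pow_sup_span_eq_top_iff (φ : K[X] →ₐ[K] B) (hφ : ∀ p P, Commute (φ p) P)
    (I : Ideal B) {b : K[X]} (hb : b ≠ 0) (hI : ∀ p, φ p ∈ I ↔ b ∣ p) (β : K) (i : ℕ) :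
    I.colon {φ (X - C β) ^ i} ⊔ Ideal.span {φ (X - C β)} = ⊤ ↔ b.rootMultiplicity β ≤ i := by
  rw [sup_span_singleton_eq_top_iff (K := K)]
  let : Ring B := Algebra.semiringToRing K
  simp only [Submodule.mem_colon_singleton, smul_eq_mul, map_neg, map_one, neg_one_mul,
    ← sub_eq_add_neg]
  obtain ⟨c, hbc, hc⟩ := exists_eq_pow_rootMultiplicity_mul_and_not_dvd b hb β
  set m := b.rootMultiplicity β
  have hc0 : c ≠ 0 := fun h => hc (h ▸ dvd_zero _)
  constructor
  · rintro ⟨R, hR⟩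
    by_contra! hlt
    -- Iterates t^i ≡ R t^(i+1) modulo I by multiplying the relation on the left by R^k t^k.
    have hk : ∀ k, φ (X - C β) ^ i - R ^ k * φ (X - C β) ^ (i + k) ∈ I := by
      intro k
      induction k with
      | zero => simp
      | succ k ih =>
        have h1 := I.add_mem ih (I.mul_mem_left (R ^ k * φ (X - C β) ^ k) hR)
        have h2 : R ^ k * φ (X - C β) ^ k * ((1 - R * φ (X - C β)) * φ (X - C β) ^ i) =
            R ^ k * φ (X - C β) ^ (i + k) - R ^ (k + 1) * φ (X - C β) ^ (i + (k + 1)) := by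
          rw [sub_mul, one_mul, mul_sub, mul_assoc, ← pow_add, add_comm k i, mul_assoc R,
            ← pow_succ', mul_assoc (R ^ k), ← mul_assoc _ R,
            ((hφ (X - C β) R).pow_left k).eq, mul_assoc R, ← pow_add, ← mul_assoc, ← pow_succ,
            show k + (i + 1) = i + (k + 1) by omega]
        rw [h2] at h1
        simpa using h1
    -- With k = m - i the power becomes t^m, and c t^m = b lies in I. Thus c t^i ∈ I, so b divides c
    -- (X - β)^i and m ≤ i.
    have h1 := I.mul_mem_left (φ c) (hk (m - i))
    rw [mul_sub, Nat.add_sub_of_le hlt.le, ← mul_assoc, (hφ c (R ^ (m - i))).eq, mul_assoc,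
      ← map_pow, ← map_pow, ← map_mul, ← map_mul, mul_comm c ((X - C β) ^ m), ← hbc] at h1
    have h2 := I.add_mem h1 (I.mul_mem_left (R ^ (m - i)) ((hI b).mpr dvd_rfl))
    rw [sub_add_cancel, hI, hbc, mul_comm c, mul_dvd_mul_iff_right hc0,
      pow_dvd_pow_iff (X_sub_C_ne_zero β) (not_isUnit_X_sub_C β)] at h2
    omega
  · intro hm
    -- From v (X - β) + u c = 1, the product (1 - v (X - β)) (X - β)^i equals u c (X - β)^i, a
    -- multiple of b when m ≤ i.
    have hcop : IsCoprime (X - C β) c :=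
      ((irreducible_X_sub_C β).coprime_iff_not_dvd).mpr hc
    obtain ⟨v, u, huv⟩ := hcop
    refine ⟨φ v, ?_⟩
    rw [← map_mul, ← map_one φ, ← map_sub, ← map_pow, ← map_mul, hI, ← huv, add_sub_cancel_left,
      hbc, mul_comm (u * c), mul_comm u c, ← mul_assoc]
    exact Dvd.dvd.mul_right (mul_dvd_mul_right (pow_dvd_pow _ hm) c) u

end CentralSubalgebra

theorem rootMultiplicity_comp_neg_X {R : Type*} [CommRing R] [IsDomain R] (p : R[X]) (a : R) :
    (p.comp (-X)).rootMultiplicity a = p.rootMultiplicity (-a) := by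
  by_cases hp : p = 0
  · simp [hp]
  have hp' : p.comp (-X) ≠ 0 := fun h => hp (by simpa using congrArg (fun q => q.comp (-X)) h)
  refine eq_of_forall_le_iff fun k => ?_
  rw [le_rootMultiplicity_iff hp', le_rootMultiplicity_iff hp, dvd_comp_neg_X_iff, pow_comp,
    sub_comp, X_comp, C_comp, C_neg, sub_neg_eq_add, show -X - C a = -(X + C a) by ring,
    neg_pow, ((isUnit_one.neg (α := R[X])).pow k).mul_left_dvd]

/-! ### The Bernstein–Sato polynomial as a generator, and specialization of s. -/

section BernsteinSatoPolynomial

variable {n : ℕ} {K : Type*} [Field K] {f : MvPolynomial (Fin n) K}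

theorem commute_ofS (b : K[X]) (P : WeylS n K) : Commute (ofS b) P := by
  have hC : ∀ a : K, Commute (C (algebraMap K (Weyl n K) a)) P := fun a =>
    Algebra.commutes (A := WeylS n K) a P
  induction b using Polynomial.induction_on with
  | C a => simpa [ofS, Algebra.ofId_apply] using hC a
  | add p q hp hq => rw [map_add]; exact hp.add_left hq
  | monomial m a _ =>
    rw [map_mul, map_pow]
    refine Commute.mul_left ?_ (Commute.pow_left ?_ _)
    · simpa [ofS, Algebra.ofId_apply] using hC a
    · simpa [ofS] using commute_X P

theorem ofS_X_sub_C_neg (α : K) : (ofS (X - C (-α)) : WeylS n K) = sAdd α := by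
  simp [ofS, sAdd]

/-- `I ∩ K[s]` is an ideal of a Euclidean domain, so a monic element of least degree generates it.
The existence theorem rules out the default value 0. -/
theorem ofS_mem_annPlus_iff [CharZero K] (hf : f ≠ 0) :
    bernsteinSato f ≠ 0 ∧ ∀ p : K[X], (ofS p : WeylS n K) ∈ annPlus f ↔ bernsteinSato f ∣ p := by
  let J : Ideal K[X] := (annPlus f).comap (ofS (n := n))
  have hJ : ∀ p, HasBernsteinEq f p ↔ p ∈ J := hasBernsteinEq_iff_mem_annPlus f
  have hmonic : ∀ p ∈ J, p ≠ 0 → (p * C p.leadingCoeff⁻¹).Monic ∧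
      HasBernsteinEq f (p * C p.leadingCoeff⁻¹) := fun p hp h0 =>
    ⟨monic_mul_leadingCoeff_inv h0, (hJ _).mpr (J.mul_mem_right _ hp)⟩
  have hne : {b : K[X] | b.Monic ∧ HasBernsteinEq f b}.Nonempty := by
    obtain ⟨b, hb0, hb⟩ := exists_hasBernsteinEq hf
    exact ⟨_, hmonic b ((hJ b).mp hb) hb0⟩
  have hdef : bernsteinSato f = Polynomial.degree_lt_wf.min _ hne := dif_pos hne
  obtain ⟨hm, hB⟩ : (bernsteinSato f).Monic ∧ HasBernsteinEq f (bernsteinSato f) := by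
    rw [hdef]
    exact Polynomial.degree_lt_wf.min_mem _ hne
  have hmin : ∀ p ∈ {b : K[X] | b.Monic ∧ HasBernsteinEq f b},
      ¬ p.degree < (bernsteinSato f).degree := by
    rw [hdef]
    exact fun p hp => Polynomial.degree_lt_wf.not_lt_min _ hp
  refine ⟨hm.ne_zero, fun p => ⟨fun hp => ?_, fun ⟨q, hq⟩ => ?_⟩⟩
  · rw [← modByMonic_eq_zero_iff_dvd hm]
    by_contra h0
    have hr : p %ₘ bernsteinSato f ∈ J := by
      rw [modByMonic_eq_sub_mul_div]
      exact J.sub_mem hp (J.mul_mem_right _ ((hJ _).mp hB))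
    have hlt := degree_modByMonic_lt p hm
    rw [← degree_mul_leadingCoeff_inv _ h0] at hlt
    exact hmin _ (hmonic _ hr h0) hlt
  · rw [hq]
    exact J.mul_mem_right q ((hJ _).mp hB)

theorem specialize_C (a : K) (P : Weyl n K) : specialize a (C P) = P := Polynomial.eval₂_C _ _

theorem specialize_X (a : K) : specialize a (X : WeylS n K) = algebraMap K _ a :=
  Polynomial.eval₂_X _ _

theorem algebraMap_neg_add (α : K) :
    algebraMap K (Weyl n K) (-α) + algebraMap K (Weyl n K) α = 0 := by
  rw [← map_add, neg_add_cancel, map_zero]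

theorem specialize_sAdd (α : K) : specialize (-α) (sAdd α : WeylS n K) = 0 := by
  rw [sAdd, map_add, specialize_X, specialize_C, algebraMap_neg_add]

/-- The remainder theorem for division by the central element s + α: the kernel of specialization is
generated by s + α. -/
theorem exists_eq_C_specialize_add (α : K) (P : WeylS n K) :
    ∃ R, P = C (specialize (-α) P) + R * sAdd α := by
  induction P using Polynomial.induction_on with
  | C a => exact ⟨0, by rw [specialize_C, zero_mul, add_zero]⟩
  | add P Q hP hQ =>
    obtain ⟨R, hR⟩ := hP
    obtain ⟨T, hT⟩ := hQ
    refine ⟨R + T, ?_⟩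
    nth_rw 1 [hR, hT]
    rw [map_add, C_add, add_mul, add_add_add_comm]
  | monomial m a h =>
    obtain ⟨R, hR⟩ := h
    refine ⟨C (specialize (-α) (C a * X ^ m)) + R * X, ?_⟩
    set a' := specialize (-α) (C a * X ^ m) with ha'
    have h1 : C a' * X = C (a' * algebraMap K _ (-α)) + C a' * sAdd α := by
      rw [sAdd, mul_add, C_mul, add_left_comm, ← mul_add, ← C_add, algebraMap_neg_add, C_0,
        mul_zero, add_zero]
    have h2 : X * sAdd α = sAdd α * (X : WeylS n K) := commute_X _
    rw [pow_succ, ← mul_assoc, map_mul, specialize_X, ← ha', add_mul, mul_assoc R, h2,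
      ← mul_assoc R, ← add_assoc, ← h1, ← add_mul, ← hR]

theorem map_specialize_eq_top_iff (α : K) (J : Ideal (WeylS n K)) :
    J.map (specialize (-α)) = ⊤ ↔ J ⊔ Ideal.span {sAdd α} = ⊤ := by
  rw [Ideal.eq_top_iff_one, Ideal.mem_map_iff_of_surjective _ fun P => ⟨C P, specialize_C _ P⟩]
  constructor
  · rintro ⟨P, hP, h⟩
    rw [sup_span_singleton_eq_top_iff (K := K)]
    obtain ⟨R, hR⟩ := exists_eq_C_specialize_add α P
    -- P = 1 + R (s + α) has to be read as 1 - (-R)(s + α).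
    refine ⟨algebraMap K _ (-1) * R, ?_⟩
    rwa [← mul_assoc, ← mul_assoc, ← map_mul, neg_one_mul, neg_neg, map_one, one_mul, ← C_1, ← h,
      ← hR]
  · rw [Ideal.eq_top_iff_one, sup_comm, Ideal.mem_span_singleton_sup]
    rintro ⟨R, P, hP, h⟩
    refine ⟨P, hP, ?_⟩
    have := congrArg (specialize (-α)) h
    rwa [map_add, map_mul, specialize_sAdd, mul_zero, zero_add, map_one] at this

end BernsteinSatoPolynomial

end BernsteinSato

end

theorem corollary2p4 {K : Type*} [Field K] [CharZero K] {n : ℕ}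
    (f : MvPolynomial (Fin n) K) (hf : f ≠ 0) (α : K) (i : ℕ) :
    List.TFAE [
      i < ((BernsteinSato.bernsteinSato f).comp (-X)).rootMultiplicity α,
      BernsteinSato.quotientIdeal f α i ⊔ Ideal.span {BernsteinSato.sAdd α} ≠ ⊤,
      (BernsteinSato.quotientIdeal f α i).map (BernsteinSato.specialize (-α)) ≠ ⊤] := by
  obtain ⟨hb, hI⟩ := BernsteinSato.ofS_mem_annPlus_iff hf
  tfae_have 1 ↔ 2 := by
    -- A root α of b_f(-s) is a root -α of b_f, so the lemma is used at -α, where X - (-α) maps to s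
    -- + α.
    have h := BernsteinSato.colon_pow_sup_span_eq_top_iff BernsteinSato.ofS
      BernsteinSato.commute_ofS _ hb hI (-α) i
    rw [BernsteinSato.ofS_X_sub_C_neg] at h
    rw [BernsteinSato.rootMultiplicity_comp_neg_X, ← not_le, ← h]
    rfl
  tfae_have 2 ↔ 3 := (BernsteinSato.map_specialize_eq_top_iff α _).not.symm
  tfae_finish
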